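/- Let $\Delta$ be a metric on a finite set $K$ with $k=|K|$ points and diameter at least $1$. Call $P\subseteq K$ an $\epsilon$-packing if the closed balls $B_\epsilon(i)=\{j\in K:\Delta(i,j)\le\epsilon\}$, $i\in P$, are pairwise disjoint; let $N^{\mathrm p}_\epsilon$ be the maximum cardinality of an $\epsilon$-packing, and let $C_p=\sup_{0<\epsilon<1}\epsilon\,N^{\mathrm p}_\epsilon$ be the packing complexity of $(K,\Delta)$. In the bandit problem with movement costs over $T$ rounds, loss functions $\ell_1,\dots,\ell_T:K\to[0,1]$ are fixed in advance. A (randomized) algorithm chooses in each round $t$ an action $i_t\in K$, at random with a distribution that may depend on its past actions $i_1,\dots,i_{t-1}$ and on the observed losses $\ell_1(i_1),\dots,\ell_{t-1}(i_{t-1})$ only. Its movement regret is $$\mathrm{Regret}(\ell_{1:T},\Delta)=\mathbb E\Big[\sum_{t=1}^T\ell_t(i_t)+\sum_{t=2}^T\Delta(i_t,i_{t-1})\Big]-\min_{i\in K}\sum_{t=1}^T\ell_t(i).$$ Theorem (Lower Bound). There are universal constants $c>0$ and $p\in\mathbb N$ such that for every finite metric space $(K,\Delta)$ with $k$ points and diameter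 at least $1$, every $T\ge k$ and every algorithm (which may depend on $K$, $\Delta$ and $T$), there is a sequence $\ell_1,\dots,\ell_T:K\to[0,1]$ of loss functions such that $$\mathrm{Regret}(\ell_{1:T},\Delta)\;\ge\;\frac{c}{(\log T)^p}\,\max\Big\{C_p^{1/3}\,T^{2/3},\ \sqrt{kT}\Big\},$$ that is, the regret is $\widetilde\Omega\big(\max\{C_p^{1/3}T^{2/3},\sqrt{kT}\}\big)$. -/

import Mathlib

namespace MovementBandit

/-- A set `P` is an `ε`-packing if the closed balls of radius `ε` around its points are
pairwise disjoint. -/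
def IsPacking {K : Type*} [MetricSpace K] (ε : ℝ) (P : Set K) : Prop :=
  P.PairwiseDisjoint (fun i => Metric.closedBall i ε)

/-- The `ε`-packing number of a finite metric space: the largest cardinality of an `ε`-packing
(the set of cardinalities contains `0` and is bounded by the number of points). -/
noncomputable def packingNumber (K : Type*) [Fintype K] [MetricSpace K] (ε : ℝ) : ℕ :=
  sSup {n : ℕ | ∃ P : Finset K, IsPacking ε (P : Set K) ∧ P.card = n}

/-- The packing complexity `sup_{0 < ε < 1} ε * N_ε` of a finite metric space
(the supremum is over a non-empty set that is bounded by the number of points). -/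
noncomputable def packingComplexity (K : Type*) [Fintype K] [MetricSpace K] : ℝ :=
  sSup ((fun ε : ℝ => ε * (packingNumber K ε : ℝ)) '' Set.Ioo 0 1)

/-- A randomized bandit algorithm: before round `t` (rounds are numbered from `0`) it has seen
the `t` pairs (action chosen, loss of that action) of the earlier rounds, and nothing else; from
these it computes the distribution of its next action. -/
def Algorithm (K : Type*) : Type _ :=
  (t : ℕ) → (Fin t → K × ℝ) → PMF K

/-- What the learner has seen before round `t` if the loss functions are `ℓ` and the
actions are `a`. -/
def history {K : Type*} {T : ℕ} (ℓ : Fin T → K → ℝ) (a : Fin T → K) (t : Fin T) :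
    Fin (t : ℕ) → K × ℝ :=
  fun s => (a (s.castLE t.isLt.le), ℓ (s.castLE t.isLt.le) (a (s.castLE t.isLt.le)))

/-- The probability that the algorithm plays exactly the actions `a` during the `T` rounds
against the fixed loss functions `ℓ`. -/
noncomputable def actionProb {K : Type*} {T : ℕ} (A : Algorithm K) (ℓ : Fin T → K → ℝ)
    (a : Fin T → K) : ℝ :=
  ∏ t : Fin T, (A t (history ℓ a t) (a t)).toReal

/-- The total movement cost of a sequence of `T` actions: the sum of the distances between
the `T - 1` pairs of consecutive actions (no cost for the first action). -/
noncomputable def movementCost {K : Type*} [MetricSpace K] {T : ℕ} (a : Fin T → K) : ℝ :=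
  ∑ t : Fin (T - 1), dist (a ⟨t + 1, by omega⟩) (a ⟨t, by omega⟩)

/-- The movement regret: the expected total loss plus movement cost of the algorithm,
minus the total loss of the best fixed action. -/
noncomputable def movementRegret {K : Type*} [Fintype K] [MetricSpace K] {T : ℕ}
    (A : Algorithm K) (ℓ : Fin T → K → ℝ) : ℝ :=
  (∑ a : Fin T → K, actionProb A ℓ a * (∑ t : Fin T, ℓ t (a t) + movementCost a))
    - ⨅ i : K, ∑ t : Fin T, ℓ t i

end MovementBandit

/-! By averaging, it suffices to bound the expected regret against random losses. Fix a set `P` of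
arms. A random walk on the cycle `ZMod N`, with two-sided geometric increments of rate `s`, is
indexed by a tree on the rounds. Every arm of `P` has the current height of the walk, scaled by `1 /
N`, as its loss; a hidden best arm `χ` lies one step lower; arms outside `P` cost `1`. The cycle
makes translations exact and keeps the losses in `[0, 1]`. Wrapping at `0`, which would spoil the
gap `1 / N`, is negligible: the root sits opposite `0`, the tree has depth at most `J`, of order
`log T`, and a cycle of length at most `66 * J ^ 2 / s` is long enough
(`sum_walkWeight_hit_zero_le`, `exists_cycle_length`).

For given actions, a translation of the walk turns the environment with best arm `χ` into the null
environment, which has none (`mean_some_eq`). A tree edge contributes at most `s ^ 2` to the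
relative entropy, and nothing unless exactly one of its ends has `χ` as the last played point of
`P`. So plays of `χ` in the two environments are comparable up to `s ^ 2` times the expected number
of informative edges in the null environment (`mean_some_le`). If these are few compared with `#P /
s ^ 2`, some arm is missed in a constant fraction of the rounds when it is best, and the regret is
of order `T / N` (`exists_movementRegret_ge`).

The dichotomy is `exists_loss_of_informs_le`: either movement in the null environment is large, and
then it is regret, or information is scarce. For `√(k T)`, take all arms and a star: every round
informs about one arm, and `s ^ 2` is of order `k / T`. For the packing term, take an `ε`-packing
and the multi-scale tree. Each round is spanned by at most `J` edges, so information is at most `2 *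
J` times the number of switches (`sum_informs_le_switches`), and every switch but the first costs
`ε` (`switches_le_moveCost`). Balancing gives `s` of order `(ε * #P / T) ^ (1 / 3) / J`. -/

namespace MovementBandit

open Finset

/-! ### Finite path measures given by causal kernels -/

section Paths

variable {X : Type*}

/-- Extend a finite sequence by a constant to an infinite one. -/
def pad (x₀ : X) {n : ℕ} (h : Fin n → X) : ℕ → X :=
  fun s => if hs : s < n then h ⟨s, hs⟩ else x₀

lemma pad_of_lt (x₀ : X) {n : ℕ} (h : Fin n → X) {s : ℕ} (hs : s < n) :
    pad x₀ h s = h ⟨s, hs⟩ := by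
  simp [pad, hs]

lemma pad_val (x₀ : X) {n : ℕ} (h : Fin n → X) (s : Fin n) : pad x₀ h s = h s := by
  simp [pad]

lemma pad_snoc (x₀ : X) {n : ℕ} (h : Fin n → X) (x : X) :
    pad x₀ (Fin.snoc h x : Fin (n + 1) → X) = Function.update (pad x₀ h) n x := by
  funext s
  rcases lt_trichotomy s n with hs | rfl | hs
  · rw [Function.update_of_ne hs.ne, pad_of_lt _ _ (Nat.lt_succ_of_lt hs), pad_of_lt _ _ hs]
    exact Fin.snoc_castSucc (α := fun _ => X) x h ⟨s, hs⟩
  · rw [Function.update_self, pad_of_lt _ _ (Nat.lt_succ_self _)]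
    exact Fin.snoc_last (α := fun _ => X) x h
  · rw [Function.update_of_ne hs.ne']
    simp [pad, show ¬ s < n + 1 by omega, show ¬ s < n by omega]

lemma sum_pad_succ [Fintype X] (x₀ : X) (n : ℕ) (F : (ℕ → X) → ℝ) :
    ∑ h : Fin (n + 1) → X, F (pad x₀ h)
      = ∑ h : Fin n → X, ∑ x, F (Function.update (pad x₀ h) n x) := by
  rw [← Fintype.sum_equiv (Fin.snocEquiv fun _ : Fin (n + 1) => X)
    (fun q => F (pad x₀ (Fin.snoc q.2 q.1 : Fin (n + 1) → X))) _ (fun _ => rfl),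
    Fintype.sum_prod_type_right]
  simp_rw [pad_snoc]

/-- A functional of infinite sequences that only looks at the coordinates below `n`. -/
def DependsBelow {Y : Type*} (n : ℕ) (f : (ℕ → X) → Y) : Prop :=
  ∀ u v : ℕ → X, (∀ s < n, u s = v s) → f u = f v

lemma DependsBelow.mono {Y : Type*} {m n : ℕ} {f : (ℕ → X) → Y} (hf : DependsBelow m f)
    (hmn : m ≤ n) : DependsBelow n f :=
  fun u v h => hf u v fun s hs => h s (hs.trans_le hmn)

lemma DependsBelow.update {Y : Type*} {m n : ℕ} {f : (ℕ → X) → Y} (hf : DependsBelow m f)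
    (hmn : m ≤ n) (u : ℕ → X) (x : X) : f (Function.update u n x) = f u :=
  hf _ _ fun s hs => Function.update_of_ne (by omega) _ _

/-- The weight of the first `n` steps of a path under the transition kernels `κ`. -/
def pathWeight (κ : ℕ → (ℕ → X) → X → ℝ) (n : ℕ) (u : ℕ → X) : ℝ :=
  ∏ t ∈ range n, κ t u (u t)

variable {κ : ℕ → (ℕ → X) → X → ℝ}

lemma pathWeight_update (hκ : ∀ t, DependsBelow t (κ t)) (n : ℕ) (u : ℕ → X) (x : X) :
    pathWeight κ (n + 1) (Function.update u n x) = pathWeight κ n u * κ n u x := by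
  rw [pathWeight, prod_range_succ, Function.update_self, (hκ n).update le_rfl, pathWeight]
  congr 1
  refine prod_congr rfl fun t ht => ?_
  have ht := mem_range.1 ht
  rw [(hκ t).update ht.le, Function.update_of_ne ht.ne]

lemma pathWeight_nonneg (h0 : ∀ t u x, 0 ≤ κ t u x) (n : ℕ) (u : ℕ → X) :
    0 ≤ pathWeight κ n u :=
  prod_nonneg fun _ _ => h0 _ _ _

variable [Fintype X]

lemma sum_pathWeight (hκ : ∀ t, DependsBelow t (κ t)) (h1 : ∀ t u, ∑ x, κ t u x = 1)
    (x₀ : X) (n : ℕ) : ∑ h : Fin n → X, pathWeight κ n (pad x₀ h) = 1 := by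
  induction n with
  | zero => simp [pathWeight]
  | succ n ih =>
    rw [sum_pad_succ]
    simp_rw [pathWeight_update hκ, ← mul_sum, h1, mul_one, ih]

/-- An additive functional whose conditional drift is nonpositive has nonpositive mean. -/
lemma sum_pathWeight_mul_nonpos (hκ : ∀ t, DependsBelow t (κ t)) (h0 : ∀ t u x, 0 ≤ κ t u x)
    (h1 : ∀ t u, ∑ x, κ t u x = 1) {f : ℕ → (ℕ → X) → ℝ}
    (hf : ∀ t, DependsBelow (t + 1) (f t))
    (hdrift : ∀ t u, ∑ x, κ t u x * f t (Function.update u t x) ≤ 0) (x₀ : X) (n : ℕ) :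
    ∑ h : Fin n → X, pathWeight κ n (pad x₀ h) * ∑ t ∈ range n, f t (pad x₀ h) ≤ 0 := by
  induction n with
  | zero => simp
  | succ n ih =>
    rw [sum_pad_succ x₀ n (fun u => pathWeight κ (n + 1) u * ∑ t ∈ range (n + 1), f t u)]
    refine le_trans (sum_le_sum fun h _ => ?_) ih
    set u := pad x₀ h
    have hsum : ∀ x, ∑ t ∈ range (n + 1), f t (Function.update u n x)
        = ∑ t ∈ range n, f t u + f n (Function.update u n x) := fun x => by
      rw [sum_range_succ]
      congr 1
      exact sum_congr rfl fun t ht => (hf t).update (mem_range.1 ht) _ _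
    have key : ∑ x, pathWeight κ (n + 1) (Function.update u n x)
          * ∑ t ∈ range (n + 1), f t (Function.update u n x)
        = pathWeight κ n u * (∑ t ∈ range n, f t u)
          + pathWeight κ n u * ∑ x, κ n u x * f n (Function.update u n x) := by
      simp_rw [hsum, pathWeight_update hκ, mul_add, sum_add_distrib, mul_assoc, ← mul_sum,
        ← sum_mul, h1, one_mul]
    rw [key]
    have := mul_nonpos_of_nonneg_of_nonpos (pathWeight_nonneg h0 n u) (hdrift n u)
    linarith

end Paths

/-! ### Two-sided geometric noise on a cycle -/

section Noise

variable {N : ℕ}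

/-- The distance of a residue class to zero. -/
def circ (g : ZMod N) : ℕ := g.valMinAbs.natAbs

lemma circ_add_le (a b : ZMod N) : circ (a + b) ≤ circ a + circ b :=
  (ZMod.natAbs_valMinAbs_add_le a b).trans (Int.natAbs_add_le _ _)

lemma circ_neg (a : ZMod N) : circ (-a) = circ a := ZMod.natAbs_valMinAbs_neg a

variable [NeZero N]

/-- The total mass of the two-sided geometric weights on the cycle. -/
noncomputable def noiseMass (N : ℕ) [NeZero N] (s : ℝ) : ℝ :=
  ∑ g : ZMod N, Real.exp (-s * circ g)

/-- The wrapped two-sided geometric distribution. -/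
noncomputable def noise (s : ℝ) (g : ZMod N) : ℝ := Real.exp (-s * circ g) / noiseMass N s

lemma one_le_noiseMass (s : ℝ) : 1 ≤ noiseMass N s := by
  have := single_le_sum (f := fun g : ZMod N => Real.exp (-s * circ g))
    (fun g _ => (Real.exp_pos _).le) (mem_univ 0)
  simpa [circ, noiseMass] using this

lemma noise_pos (s : ℝ) (g : ZMod N) : 0 < noise s g :=
  div_pos (Real.exp_pos _) (by linarith [one_le_noiseMass (N := N) s])

lemma sum_noise (s : ℝ) : ∑ g : ZMod N, noise s g = 1 := by
  simp_rw [noise, ← sum_div]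
  exact div_self (by linarith [one_le_noiseMass (N := N) s] : noiseMass N s ≠ 0)

lemma noise_le (s : ℝ) (g : ZMod N) : noise s g ≤ Real.exp (-s * circ g) :=
  div_le_self (Real.exp_pos _).le (one_le_noiseMass s)

lemma log_noise_sub (s : ℝ) (g h : ZMod N) :
    Real.log (noise s g) - Real.log (noise s h) = s * ((circ h : ℝ) - circ g) := by
  have hZ : noiseMass N s ≠ 0 := by linarith [one_le_noiseMass (N := N) s]
  rw [noise, noise, Real.log_div (Real.exp_ne_zero _) hZ, Real.log_div (Real.exp_ne_zero _) hZ,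
    Real.log_exp, Real.log_exp]
  ring

/-- Shifting the noise by at most one step costs relative entropy at most `s ^ 2`. -/
lemma relEntropy_noise_le {s : ℝ} (hs0 : 0 ≤ s) (hs1 : s ≤ 1) {δ : ZMod N} (hδ : circ δ ≤ 1)
    (v : ZMod N) :
    ∑ g : ZMod N, noise s (g - v)
      * (Real.log (noise s (g - v)) - Real.log (noise s (g - v + δ))) ≤ s ^ 2 := by
  rw [Fintype.sum_equiv (Equiv.subRight v) _ (fun g : ZMod N => noise s g
      * (Real.log (noise s g) - Real.log (noise s (g + δ)))) (fun g => by simp)]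
  set u : ZMod N → ℝ := fun g => Real.log (noise s g) - Real.log (noise s (g + δ)) with hu
  have habs : ∀ g, |u g| ≤ s := fun g => by
    simp only [hu, log_noise_sub, abs_mul, abs_of_nonneg hs0]
    refine mul_le_of_le_one_right hs0 ?_
    have h1 : circ (g + δ) ≤ circ g + 1 := (circ_add_le g δ).trans (by omega)
    have h2 : circ g ≤ circ (g + δ) + 1 := by
      have := circ_add_le (g + δ) (-δ)
      rw [add_neg_cancel_right, circ_neg] at this
      omega
    rw [abs_le]
    constructor <;> [have := h2; have := h1] <;>
      · have : (_ : ℝ) ≤ _ := Nat.cast_le.2 this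
        push_cast at this
        linarith
  have hshift : ∀ g, noise s g * Real.exp (-u g) = noise s (g + δ) := fun g => by
    simp only [hu, neg_sub, Real.exp_sub, Real.exp_log (noise_pos _ _)]
    field_simp [(noise_pos s g).ne']
  have hsum : ∑ g, noise s (g + δ) = 1 := by
    rw [Fintype.sum_equiv (Equiv.addRight δ) _ (fun g : ZMod N => noise s g) (fun g => by simp)]
    exact sum_noise s
  -- This is `exp (-u) ≤ 1 - u + u ^ 2`, weighted by the noise. The zeroth-order terms cancel after
  -- summation because the shifted noise also has mass one, which leaves the quadratic term.
  have hpt : ∀ g, noise s g * u g ≤ noise s g + noise s g * s ^ 2 - noise s (g + δ) := fun g => by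
    have h1 := (abs_le.1 (Real.abs_exp_sub_one_sub_id_le (x := -u g)
      (by rw [abs_neg]; exact (habs g).trans hs1))).2
    have h2 : u g ^ 2 ≤ s ^ 2 := sq_le_sq' (abs_le.1 (habs g)).1 (abs_le.1 (habs g)).2
    rw [← hshift]
    nlinarith [noise_pos s g]
  refine (sum_le_sum fun g _ => hpt g).trans ?_
  rw [sum_sub_distrib, sum_add_distrib, ← sum_mul, sum_noise, hsum]
  linarith

/-- A crude union over all `N` residues; the factor `N` is harmless because `s * m` will be chosen
of order `J`. -/
lemma sum_noise_tail_le {s : ℝ} (hs0 : 0 ≤ s) (m : ℕ) (v : ZMod N) :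
    ∑ g : ZMod N, noise s (g - v) * (if m ≤ circ (g - v) then 1 else 0)
      ≤ N * Real.exp (-s * m) := by
  calc _ ≤ ∑ _g : ZMod N, Real.exp (-s * m) := sum_le_sum fun g _ => by
        split_ifs with h
        · rw [mul_one]
          refine (noise_le _ _).trans (Real.exp_le_exp.2 ?_)
          have : (m : ℝ) ≤ circ (g - v) := by exact_mod_cast h
          nlinarith
        · simp [Real.exp_nonneg]
    _ = _ := by simp [ZMod.card]

end Noise

/-! ### The tree-indexed random walk -/

section Walk

/-- The values along the tree: the root has value `c`, node `t + 1` has value `y t`. -/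
def node {G : Type*} (c : G) (y : ℕ → G) : ℕ → G
  | 0 => c
  | t + 1 => y t

lemma node_dependsBelow {G : Type*} (c : G) (n : ℕ) :
    DependsBelow n (fun y : ℕ → G => node c y n) := by
  intro u v h
  cases n with
  | zero => rfl
  | succ n => exact h n (Nat.lt_succ_self n)

variable {N : ℕ}

/-- Telescope along the ancestors up to the root. The induction is strong because a parent may lie
far in the past. -/
lemma circ_node_sub_le {π dep : ℕ → ℕ} (hπ : ∀ t, π t ≤ t) {T : ℕ}
    (hdep : ∀ t < T, dep (π t) + 1 ≤ dep (t + 1)) {c : ZMod N} {y : ℕ → ZMod N} {q : ℕ}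
    (hq : ∀ t < T, circ (y t - node c y (π t)) ≤ q) (n : ℕ) (hn : n ≤ T) :
    circ (node c y n - c) ≤ dep n * q := by
  induction n using Nat.strong_induction_on with
  | _ n ih =>
    cases n with
    | zero => simp [node, circ]
    | succ t =>
      have h1 := ih (π t) (Nat.lt_succ_of_le (hπ t)) ((hπ t).trans (by omega))
      have h2 := circ_add_le (y t - node c y (π t)) (node c y (π t) - c)
      rw [sub_add_sub_cancel] at h2
      calc circ (y t - c) ≤ q + dep (π t) * q := h2.trans (add_le_add (hq t hn) h1)
        _ = (dep (π t) + 1) * q := by ring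
        _ ≤ dep (t + 1) * q := Nat.mul_le_mul_right _ (hdep t hn)

variable [NeZero N]

/-- The transition kernels of the tree-indexed random walk with parent function `π`. -/
noncomputable def walkKernel (s : ℝ) (π : ℕ → ℕ) (c : ZMod N) (t : ℕ) (y : ℕ → ZMod N)
    (g : ZMod N) : ℝ := noise s (g - node c y (π t))

lemma walkKernel_dependsBelow (s : ℝ) {π : ℕ → ℕ} (hπ : ∀ t, π t ≤ t) (c : ZMod N) (t : ℕ) :
    DependsBelow t (walkKernel s π c t) := by
  intro u v h
  funext g
  have := ((node_dependsBelow c (π t)).mono (hπ t)) u v h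
  simp only at this
  rw [walkKernel, walkKernel, this]

lemma sum_walkKernel (s : ℝ) (π : ℕ → ℕ) (c : ZMod N) (t : ℕ) (y : ℕ → ZMod N) :
    ∑ g, walkKernel s π c t y g = 1 := by
  rw [Fintype.sum_equiv (Equiv.subRight (node c y (π t))) _ (fun g : ZMod N => noise s g)
    (fun g => by simp [walkKernel])]
  exact sum_noise s

/-- The probability weight of the first `T` values of the tree-indexed random walk. -/
noncomputable def walkWeight (s : ℝ) (π : ℕ → ℕ) (c : ZMod N) (T : ℕ) : (ℕ → ZMod N) → ℝ :=
  pathWeight (walkKernel s π c) T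

lemma walkWeight_dependsBelow (s : ℝ) {π : ℕ → ℕ} (hπ : ∀ t, π t ≤ t) (c : ZMod N) (T : ℕ) :
    DependsBelow T (walkWeight s π c T) := by
  intro u v h
  unfold walkWeight pathWeight
  refine prod_congr rfl fun t ht => ?_
  have ht := mem_range.1 ht
  rw [h t ht, walkKernel_dependsBelow s hπ c t u v fun s hs => h s (hs.trans ht)]

lemma walkWeight_pos (s : ℝ) (π : ℕ → ℕ) (c : ZMod N) (T : ℕ) (y : ℕ → ZMod N) :
    0 < walkWeight s π c T y := by
  unfold walkWeight pathWeight
  exact prod_pos fun _ _ => noise_pos _ _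

lemma sum_walkWeight (s : ℝ) {π : ℕ → ℕ} (hπ : ∀ t, π t ≤ t) (c : ZMod N) (T : ℕ) :
    ∑ w : Fin T → ZMod N, walkWeight s π c T (pad 0 w) = 1 :=
  sum_pathWeight (walkKernel_dependsBelow s hπ c) (sum_walkKernel s π c) 0 T

/-- The walk started opposite to `0` rarely visits `0`. -/
lemma sum_walkWeight_hit_zero_le {s : ℝ} (hs0 : 0 ≤ s) {π dep : ℕ → ℕ} (hπ : ∀ t, π t ≤ t)
    {T J m : ℕ} (hdep : ∀ t < T, dep (π t) + 1 ≤ dep (t + 1)) (hJ : ∀ n ≤ T, dep n ≤ J)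
    {c : ZMod N} (hm : 0 < m) (hJ0 : 0 < J) (hc : circ c = J * m) {t : ℕ} (ht : t < T) :
    ∑ w : Fin T → ZMod N, walkWeight s π c T (pad 0 w) * (if pad 0 w t = 0 then 1 else 0)
      ≤ T * (N * Real.exp (-s * m)) := by
  -- The value `0` is at distance `J * m` from the root, and at most `J` increments lead to any
  -- node, so a visit to `0` forces some increment of size at least `m`.
  have hpt : ∀ y : ℕ → ZMod N, (if y t = 0 then (1 : ℝ) else 0)
      ≤ ∑ r ∈ range T, if m ≤ circ (y r - node c y (π r)) then (1 : ℝ) else 0 := fun y => by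
    have hnn : ∀ r ∈ range T, (0 : ℝ) ≤ if m ≤ circ (y r - node c y (π r)) then (1 : ℝ) else 0 :=
      fun r _ => by split_ifs <;> norm_num
    split_ifs with h0
    · by_contra hlt
      have hq : ∀ r < T, circ (y r - node c y (π r)) ≤ m - 1 := fun r hr => by
        by_contra hr'
        refine hlt (le_trans ?_ (single_le_sum hnn (mem_range.2 hr)))
        rw [if_pos (by omega)]
      have h1 := circ_node_sub_le hπ hdep hq (t + 1) ht
      rw [show node c y (t + 1) = 0 from h0, zero_sub, circ_neg, hc] at h1
      have h2 : dep (t + 1) * (m - 1) ≤ J * (m - 1) := Nat.mul_le_mul_right _ (hJ _ ht)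
      have h3 : J * (m - 1) < J * m := Nat.mul_lt_mul_of_pos_left (by omega) hJ0
      omega
    · exact sum_nonneg hnn
  have hdrift := sum_pathWeight_mul_nonpos (walkKernel_dependsBelow s hπ c)
    (fun _ _ _ => (noise_pos _ _).le) (sum_walkKernel s π c)
    (f := fun r y => (if m ≤ circ (y r - node c y (π r)) then (1 : ℝ) else 0)
      - N * Real.exp (-s * m)) (fun r u v h => by
        have h1 := ((node_dependsBelow c (π r)).mono ((hπ r).trans r.le_succ)) u v h
        simp only at h1
        simp only [h1, h r r.lt_succ_self])
    (fun r u => by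
      have h1 : ∀ x, node c (Function.update u r x) (π r) = node c u (π r) := fun x =>
        (node_dependsBelow c (π r)).update (hπ r) u x
      simp only [h1, Function.update_self, mul_sub, sum_sub_distrib, ← sum_mul, sum_walkKernel]
      have := sum_noise_tail_le hs0 m (node c u (π r))
      simp only [walkKernel]
      linarith) 0 T
  simp only [sum_sub_distrib, mul_sub, ← sum_mul, sum_const, card_range, nsmul_eq_mul] at hdrift
  change _ - (∑ w : Fin T → ZMod N, walkWeight s π c T (pad 0 w)) * _ ≤ 0 at hdrift
  rw [sum_walkWeight s hπ, one_mul] at hdrift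
  refine le_trans (sum_le_sum fun w _ =>
    mul_le_mul_of_nonneg_left (hpt _) (walkWeight_pos _ _ _ _ _).le) ?_
  change ∑ w : Fin T → ZMod N, walkWeight s π c T (pad 0 w) * _ - _ ≤ 0 at hdrift
  linarith

end Walk

/-! ### The multi-scale tree: logarithmic depth and width -/

section Tree

/-- The parent of node `t + 1` in the multi-scale tree: clear the lowest binary digit. -/
def multiscale (t : ℕ) : ℕ := t + 1 - 2 ^ padicValNat 2 (t + 1)

/-- The depth bound for node `n` in the multi-scale tree with nodes below `2 ^ J`. -/
def multiscaleDepth (J n : ℕ) : ℕ := if n = 0 then 0 else J - padicValNat 2 n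

lemma multiscale_le (t : ℕ) : multiscale t ≤ t := by
  have : 0 < 2 ^ padicValNat 2 (t + 1) := by positivity
  unfold multiscale
  omega

lemma padicValNat_lt_of_lt_pow {J n : ℕ} (h0 : n ≠ 0) (h : n < 2 ^ J) : padicValNat 2 n < J :=
  (Nat.pow_lt_pow_iff_right (a := 2) (by norm_num)).1
    ((Nat.le_of_dvd (Nat.pos_of_ne_zero h0) pow_padicValNat_dvd).trans_lt h)

lemma multiscaleDepth_le (J n : ℕ) : multiscaleDepth J n ≤ J := by
  unfold multiscaleDepth
  split_ifs <;> omega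

/-- Write `t + 1` as `2 ^ v` times an odd number; subtracting `2 ^ v` makes the cofactor even. -/
lemma padicValNat_multiscale {t : ℕ} (h : multiscale t ≠ 0) :
    padicValNat 2 (t + 1) < padicValNat 2 (multiscale t) := by
  obtain ⟨q, hq⟩ : 2 ^ padicValNat 2 (t + 1) ∣ t + 1 := pow_padicValNat_dvd
  set v := padicValNat 2 (t + 1) with hv
  have hodd : ¬ 2 ∣ q := fun ⟨r, hr⟩ => by
    have : 2 ^ (v + 1) ∣ t + 1 := ⟨r, by rw [hq, hr, pow_succ]; ring⟩
    rw [padicValNat_dvd_iff_le (by omega)] at this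
    omega
  have : 2 ^ (v + 1) ∣ multiscale t := by
    obtain ⟨r, hr⟩ : ∃ r, q = 2 * r + 1 := ⟨q / 2, by omega⟩
    refine ⟨r, ?_⟩
    unfold multiscale
    rw [← hv, hq, hr, pow_succ, Nat.sub_eq_iff_eq_add (by nlinarith [Nat.zero_le (2 ^ v * r)])]
    ring
  rw [padicValNat_dvd_iff_le h] at this
  omega

lemma multiscaleDepth_parent {J t : ℕ} (h : t + 1 < 2 ^ J) :
    multiscaleDepth J (multiscale t) + 1 ≤ multiscaleDepth J (t + 1) := by
  have hlt := padicValNat_lt_of_lt_pow (Nat.succ_ne_zero t) h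
  unfold multiscaleDepth
  rw [if_neg (Nat.succ_ne_zero t)]
  simp only [Nat.succ_eq_add_one] at hlt
  split_ifs with h0
  · omega
  · have h1 := padicValNat_multiscale h0
    have h2 := padicValNat_lt_of_lt_pow h0
      (show multiscale t < 2 ^ J from (multiscale_le t).trans_lt (by omega))
    omega

/-- Edges spanning `r` have distinct valuations. If `a < b` shared the valuation `v`, then `2 ^ v`
would divide `b - a`, so the parent `b + 1 - 2 ^ v` of node `b + 1` would be at least `a + 1 > r`.
-/
lemma multiscale_width {J T : ℕ} (hT : T < 2 ^ J) (r : ℕ) :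
    #{t ∈ range T | multiscale t ≤ r ∧ r ≤ t} ≤ J := by
  rw [← card_range J]
  refine card_le_card_of_injOn (fun t => padicValNat 2 (t + 1)) (fun t ht => ?_) ?_
  · simp only [coe_filter, mem_range, Set.mem_ofPred_eq] at ht
    exact mem_coe.2 (mem_range.2 (padicValNat_lt_of_lt_pow (Nat.succ_ne_zero t) (by omega)))
  · have key : ∀ a b : ℕ, multiscale b ≤ r → r ≤ a → a < b →
        padicValNat 2 (a + 1) = padicValNat 2 (b + 1) → False := fun a b hb ha hab h => by
      have h1 : 2 ^ padicValNat 2 (b + 1) ∣ a + 1 := h ▸ pow_padicValNat_dvd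
      have h2 : 2 ^ padicValNat 2 (b + 1) ∣ b + 1 := pow_padicValNat_dvd
      have h3 := Nat.le_of_dvd (by omega) (Nat.dvd_sub h2 h1)
      unfold multiscale at hb
      omega
    intro a ha b hb h
    simp only [coe_filter, mem_range, Set.mem_ofPred_eq] at ha hb
    rcases lt_trichotomy a b with hab | hab | hab
    · exact (key a b hb.2.1 ha.2.2 hab h).elim
    · exact hab
    · exact (key b a ha.2.1 hb.2.2 hab h.symm).elim

end Tree

/-! ### The law of the actions against fixed losses -/

section Actions

variable {K : Type*}

/-- The distribution of the next action of the algorithm against the losses `ℓ`. -/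
noncomputable def actKernel (A : Algorithm K) (ℓ : ℕ → K → ℝ) (t : ℕ) (b : ℕ → K) (j : K) : ℝ :=
  (A t (fun s : Fin t => (b s, ℓ s (b s))) j).toReal

lemma actKernel_dependsBelow (A : Algorithm K) (ℓ : ℕ → K → ℝ) (t : ℕ) :
    DependsBelow t (actKernel A ℓ t) := by
  intro u v h
  funext j
  unfold actKernel
  congr 3
  funext s
  rw [h s s.2]

lemma sum_actKernel [Fintype K] (A : Algorithm K) (ℓ : ℕ → K → ℝ) (t : ℕ) (b : ℕ → K) :
    ∑ j, actKernel A ℓ t b j = 1 := by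
  unfold actKernel
  rw [← ENNReal.toReal_sum fun j _ => PMF.apply_ne_top _ _, ← tsum_fintype (L := .unconditional _),
    PMF.tsum_coe, ENNReal.toReal_one]

lemma actKernel_congr (A : Algorithm K) {ℓ ℓ' : ℕ → K → ℝ} {t : ℕ} {b : ℕ → K}
    (h : ∀ s < t, ℓ s (b s) = ℓ' s (b s)) : actKernel A ℓ t b = actKernel A ℓ' t b := by
  funext j
  unfold actKernel
  congr 3
  funext s
  rw [h s s.2]

/-- The probability weight of the first `T` actions against the losses `ℓ`. -/
noncomputable def actWeight (A : Algorithm K) (ℓ : ℕ → K → ℝ) (T : ℕ) : (ℕ → K) → ℝ :=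
  pathWeight (actKernel A ℓ) T

lemma actionProb_eq (A : Algorithm K) (ℓ : ℕ → K → ℝ) {T : ℕ} (k₀ : K) (a : Fin T → K) :
    actionProb A (fun t : Fin T => ℓ t) a = actWeight A ℓ T (pad k₀ a) := by
  unfold actionProb actWeight pathWeight
  rw [← Fin.prod_univ_eq_prod_range (fun t => actKernel A ℓ t (pad k₀ a) (pad k₀ a t)) T]
  refine prod_congr rfl fun t _ => ?_
  rw [actKernel, pad_val]
  congr 3
  funext s
  have : pad k₀ a s = a (s.castLE t.isLt.le) := pad_of_lt k₀ a (s.2.trans t.2)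
  rw [this]
  rfl

lemma actWeight_nonneg (A : Algorithm K) (ℓ : ℕ → K → ℝ) (T : ℕ) (b : ℕ → K) :
    0 ≤ actWeight A ℓ T b :=
  pathWeight_nonneg (fun _ _ _ => ENNReal.toReal_nonneg) _ _

lemma sum_actWeight [Fintype K] (A : Algorithm K) (ℓ : ℕ → K → ℝ) (T : ℕ) (k₀ : K) :
    ∑ a : Fin T → K, actWeight A ℓ T (pad k₀ a) = 1 :=
  sum_pathWeight (actKernel_dependsBelow A ℓ) (sum_actKernel A ℓ) k₀ T

end Actions

/-! ### The losses and the coupling with the null environment -/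

section Environment

variable {K : Type*} [DecidableEq K] {N : ℕ}

/-- The last point of `P` played before round `n`, if any. -/
def lastIn (P : Finset K) (b : ℕ → K) : ℕ → Option K
  | 0 => none
  | t + 1 => if b t ∈ P then some (b t) else lastIn P b t

lemma lastIn_dependsBelow (P : Finset K) (n : ℕ) :
    DependsBelow n (fun b : ℕ → K => lastIn P b n) := by
  induction n with
  | zero => exact fun _ _ _ => rfl
  | succ n ih =>
    intro u v h
    have h1 := ih u v fun s hs => h s (hs.trans n.lt_succ_self)
    simp only at h1
    simp only [lastIn, h n n.lt_succ_self, h1]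

/-- The amount by which the observation at node `n` is lowered if `χ` is the best arm. -/
def lowering (N : ℕ) (P : Finset K) (χ : K) (b : ℕ → K) (n : ℕ) : ZMod N :=
  if lastIn P b n = some χ then 1 else 0

/-- Whether the observation at node `t + 1`, given that at its parent, reveals information
about `χ`. -/
def informs (π : ℕ → ℕ) (P : Finset K) (χ : K) (b : ℕ → K) (t : ℕ) : ℝ :=
  if (lastIn P b (t + 1) = some χ ↔ lastIn P b (π t) = some χ) then 0 else 1

/-- The loss functions built from the walk `y` with best arm `χ` (or none): outside of `P` the
loss is `1`, on `P` it is the height of the walk, lowered by one step at the best arm. -/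
noncomputable def envLoss (P : Finset K) (χ : Option K) (y : ℕ → ZMod N) (t : ℕ) (j : K) : ℝ :=
  if j ∈ P then ((y t - if χ = some j then 1 else 0).val : ℝ) / N else 1

lemma envLoss_mem_Icc [NeZero N] (P : Finset K) (χ : Option K) (y : ℕ → ZMod N) (t : ℕ) (j : K) :
    envLoss P χ y t j ∈ Set.Icc (0 : ℝ) 1 := by
  unfold envLoss
  split_ifs
  all_goals first
    | exact ⟨by positivity,
        div_le_one_of_le₀ (by exact_mod_cast (ZMod.val_lt _).le) (by positivity)⟩
    | simp

/-- On `P` the last played point is the current action, so the lowering cancels against the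
advantage of `χ`. Off `P` the loss is `1` whatever the walk does, so keeping the previous lowering
there is free and avoids spurious information. -/
lemma envLoss_lowering (P : Finset K) (χ : K) (y : ℕ → ZMod N) (b : ℕ → K) (t : ℕ) :
    envLoss P (some χ) (fun n => y n + lowering N P χ b (n + 1)) t (b t)
      = envLoss P none y t (b t) := by
  unfold envLoss lowering
  split_ifs with h1 <;> simp_all [lastIn, eq_comm]

lemma actWeight_envLoss_congr (A : Algorithm K) (P : Finset K) (χ : Option K) (T : ℕ) (b : ℕ → K) :
    DependsBelow T (fun y : ℕ → ZMod N => actWeight A (envLoss P χ y) T b) := by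
  intro u v h
  unfold actWeight pathWeight
  refine prod_congr rfl fun t ht => ?_
  rw [actKernel_congr A fun s hs => ?_]
  simp only [envLoss, h s (hs.trans (mem_range.1 ht))]

lemma actWeight_lowering (A : Algorithm K) (P : Finset K) (χ : K) (y : ℕ → ZMod N) (T : ℕ)
    (b : ℕ → K) :
    actWeight A (envLoss P (some χ) (fun n => y n + lowering N P χ b (n + 1))) T b
      = actWeight A (envLoss P none y) T b := by
  unfold actWeight pathWeight
  exact prod_congr rfl fun _ _ => by rw [actKernel_congr A fun s _ => envLoss_lowering P χ y b s]

end Environment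

/-! ### Likelihood ratios of the lowered walk -/

section Lowering

variable {K : Type*} [DecidableEq K] {N : ℕ} (P : Finset K) (s : ℝ) {π : ℕ → ℕ} (c : ZMod N)
  (T : ℕ)

lemma node_lowering (χ : K) (y : ℕ → ZMod N) (b : ℕ → K) (n : ℕ) :
    node c (fun n => y n + lowering N P χ b (n + 1)) n = node c y n + lowering N P χ b n := by
  cases n <;> simp [node, lowering, lastIn]

variable [NeZero N]

/-- The log-likelihood ratio of one step of the walk against its lowered version. -/
noncomputable def logRatio (π : ℕ → ℕ) (χ : K) (t : ℕ) (b : ℕ → K) (y : ℕ → ZMod N) : ℝ :=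
  Real.log (noise s (y t - node c y (π t)))
    - Real.log (noise s (y t - node c y (π t)
      + (lowering N P χ b (t + 1) - lowering N P χ b (π t))))

/-- The root is never lowered, since no point has been played before round `0`. Hence each increment
changes exactly by the difference of the lowerings at the two ends of its edge. -/
lemma walkWeight_lowering (χ : K) (b : ℕ → K) (y : ℕ → ZMod N) :
    walkWeight s π c T (fun n => y n + lowering N P χ b (n + 1))
      = walkWeight s π c T y * Real.exp (-∑ t ∈ range T, logRatio P s c π χ t b y) := by
  rw [← sum_neg_distrib, Real.exp_sum]
  unfold walkWeight pathWeight
  rw [← prod_mul_distrib]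
  refine prod_congr rfl fun t _ => ?_
  rw [logRatio, neg_sub, Real.exp_sub, Real.exp_log (noise_pos _ _), Real.exp_log (noise_pos _ _),
    walkKernel, walkKernel, node_lowering, mul_div_cancel₀ _ (noise_pos _ _).ne']
  congr 1
  ring

lemma circ_lowering_sub_le (χ : K) (b : ℕ → K) (m n : ℕ) :
    circ (lowering N P χ b m - lowering N P χ b n) ≤ 1 := by
  have h1 : circ (1 : ZMod N) ≤ 1 := by
    rw [circ, ZMod.valMinAbs_natAbs_eq_min, ZMod.val_one_eq_one_mod]
    exact (min_le_left _ _).trans (Nat.mod_le _ _)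
  have h0 : circ (0 : ZMod N) = 0 := by simp [circ]
  unfold lowering
  split_ifs
  · simp [h0]
  · simpa using h1
  · simpa [circ_neg] using h1
  · simp [h0]

/-- A pointwise substitute for Pinsker's inequality: when `exp (-L)` is a likelihood ratio, the mean
of the nonnegative term `L - 1 + exp (-L)` is the relative entropy. The constants come from the
tangent of `log` at `3 / 2`. -/
lemma mul_exp_neg_le {F L : ℝ} (h0 : 0 ≤ F) (h1 : F ≤ 1) :
    F * Real.exp (-L) ≤ 3 / 2 * F + 3 * (L - 1 + Real.exp (-L)) := by
  have hx := Real.exp_pos (-L)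
  have hψ : 0 ≤ L - 1 + Real.exp (-L) := by linarith [Real.add_one_le_exp (-L)]
  have h2 : Real.exp (-L) - 3 / 2 ≤ 3 * (L - 1 + Real.exp (-L)) := by
    have e1 := Real.log_le_sub_one_of_pos (show 0 < Real.exp (-L) / (3 / 2) by positivity)
    rw [Real.log_div hx.ne' (by norm_num), Real.log_exp] at e1
    have e2 := Real.log_le_sub_one_of_pos (show (0 : ℝ) < 3 / 2 by norm_num)
    linarith
  nlinarith

end Lowering

lemma sum_pad_prod {K : Type*} [Fintype K] {N : ℕ} [NeZero N] (k₀ : K) (T : ℕ)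
    (F : (ℕ → K) → (ℕ → ZMod N) → ℝ) :
    ∑ h : Fin T → K × ZMod N, F (fun r => (pad (k₀, 0) h r).1) (fun r => (pad (k₀, 0) h r).2)
      = ∑ w : Fin T → ZMod N, ∑ a : Fin T → K, F (pad k₀ a) (pad 0 w) := by
  rw [← Fintype.sum_prod_type_right (f := fun q : (Fin T → K) × (Fin T → ZMod N) =>
    F (pad k₀ q.1) (pad 0 q.2))]
  refine Fintype.sum_equiv (Equiv.arrowProdEquivProdArrow (Fin T) (fun _ => K) fun _ => ZMod N) _ _
    fun h => ?_
  have h1 : (fun r => (pad (k₀, (0 : ZMod N)) h r).1)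
      = pad k₀ (Equiv.arrowProdEquivProdArrow (Fin T) (fun _ => K) (fun _ => ZMod N) h).1 := by
    funext r
    unfold pad
    split_ifs <;> rfl
  have h2 : (fun r => (pad (k₀, (0 : ZMod N)) h r).2)
      = pad 0 (Equiv.arrowProdEquivProdArrow (Fin T) (fun _ => K) (fun _ => ZMod N) h).2 := by
    funext r
    unfold pad
    split_ifs <;> rfl
  rw [h1, h2]

/-! ### Comparison of the environments -/

section ChangeOfMeasure

variable {K : Type*} [DecidableEq K] [Fintype K] {N : ℕ} [NeZero N]

/-- The mean of a functional of the actions when the losses are drawn from the random walk with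
best arm `χ`. -/
noncomputable def mean (A : Algorithm K) (P : Finset K) (s : ℝ) (π : ℕ → ℕ) (c : ZMod N)
    (k₀ : K) (T : ℕ) (χ : Option K) (F : (ℕ → K) → ℝ) : ℝ :=
  ∑ w : Fin T → ZMod N, walkWeight s π c T (pad 0 w)
    * ∑ a : Fin T → K, actWeight A (envLoss P χ (pad 0 w)) T (pad k₀ a) * F (pad k₀ a)

variable (A : Algorithm K) (P : Finset K) (s : ℝ) (π : ℕ → ℕ) (c : ZMod N) (k₀ : K) (T : ℕ)

lemma mean_mono (χ : Option K) {F F' : (ℕ → K) → ℝ} (h : ∀ b, F b ≤ F' b) :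
    mean A P s π c k₀ T χ F ≤ mean A P s π c k₀ T χ F' :=
  sum_le_sum fun _ _ => mul_le_mul_of_nonneg_left (sum_le_sum fun _ _ =>
    mul_le_mul_of_nonneg_left (h _) (actWeight_nonneg _ _ _ _)) (walkWeight_pos _ _ _ _ _).le

lemma mean_smul (χ : Option K) (r : ℝ) (F : (ℕ → K) → ℝ) :
    mean A P s π c k₀ T χ (fun b => r * F b) = r * mean A P s π c k₀ T χ F := by
  simp only [mean, mul_sum]
  exact sum_congr rfl fun _ _ => sum_congr rfl fun _ _ => by ring

lemma mean_add (χ : Option K) (F F' : (ℕ → K) → ℝ) :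
    mean A P s π c k₀ T χ (fun b => F b + F' b)
      = mean A P s π c k₀ T χ F + mean A P s π c k₀ T χ F' := by
  simp only [mean, mul_add, sum_add_distrib]

lemma mean_sum {ι : Type*} (χ : Option K) (I : Finset ι) (F : ι → (ℕ → K) → ℝ) :
    mean A P s π c k₀ T χ (fun b => ∑ i ∈ I, F i b) = ∑ i ∈ I, mean A P s π c k₀ T χ (F i) := by
  simp only [mean, mul_sum]
  rw [sum_comm' (t' := univ) (s' := fun _ => I) (by simp)]
  refine sum_congr rfl fun w _ => ?_
  rw [sum_comm]

variable {π}

lemma mean_eq_sum_sum (χ : Option K) (F : (ℕ → K) → ℝ) :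
    mean A P s π c k₀ T χ F = ∑ w : Fin T → ZMod N, ∑ a : Fin T → K, walkWeight s π c T (pad 0 w)
      * (actWeight A (envLoss P χ (pad 0 w)) T (pad k₀ a) * F (pad k₀ a)) := by
  simp_rw [mean, mul_sum]

lemma mean_const (hπ : ∀ t, π t ≤ t) (χ : Option K) (r : ℝ) :
    mean A P s π c k₀ T χ (fun _ => r) = r := by
  simp only [mean, ← sum_mul, sum_actWeight, one_mul, sum_walkWeight s hπ]

/-- For fixed actions, adding the lowering is a bijection of the walks, because heights live in a
group. The translation depends on the actions, so the sum over actions is moved outside first. -/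
lemma mean_some_eq (hπ : ∀ t, π t ≤ t) (χ : K) (F : (ℕ → K) → ℝ) :
    mean A P s π c k₀ T (some χ) F = ∑ w : Fin T → ZMod N, ∑ a : Fin T → K,
      walkWeight s π c T (fun n => pad 0 w n + lowering N P χ (pad k₀ a) (n + 1))
        * (actWeight A (envLoss P none (pad 0 w)) T (pad k₀ a) * F (pad k₀ a)) := by
  unfold mean
  simp_rw [mul_sum]
  rw [sum_comm, sum_comm (s := (univ : Finset (Fin T → ZMod N)))]
  refine sum_congr rfl fun a _ => ?_
  set b := pad k₀ a
  refine (Fintype.sum_equiv (Equiv.addRight (fun t : Fin T => lowering N P χ b (t + 1))) _ _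
    fun w => ?_).symm
  have hagree : ∀ n < T, pad 0 w n + lowering N P χ b (n + 1)
      = pad 0 (Equiv.addRight (fun t : Fin T => lowering N P χ b (t + 1)) w) n := fun n hn => by
    rw [pad_of_lt _ _ hn, pad_of_lt _ _ hn]
    rfl
  rw [← actWeight_lowering A P χ, walkWeight_dependsBelow s hπ c T _ _ hagree]
  have := actWeight_envLoss_congr A P (some χ) T b _ _ hagree
  simp only at this
  rw [this]

/-- The joint transition kernels of actions and walk when no arm is best. -/
noncomputable def jointKernel (π : ℕ → ℕ) (t : ℕ) (u : ℕ → K × ZMod N) (x : K × ZMod N) : ℝ :=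
  actKernel A (envLoss P none fun r => (u r).2) t (fun r => (u r).1) x.1
    * walkKernel s π c t (fun r => (u r).2) x.2

/-- Under the null environment the expected log-likelihood ratio is controlled by the number
of informative rounds. -/
lemma mean_logRatio_le (hπ : ∀ t, π t ≤ t) (hs0 : 0 ≤ s) (hs1 : s ≤ 1) (χ : K) :
    ∑ w : Fin T → ZMod N, ∑ a : Fin T → K, walkWeight s π c T (pad 0 w)
        * (actWeight A (envLoss P none (pad 0 w)) T (pad k₀ a)
          * ∑ t ∈ range T, logRatio P s c π χ t (pad k₀ a) (pad 0 w))
      ≤ s ^ 2 * mean A P s π c k₀ T none (fun b => ∑ t ∈ range T, informs π P χ b t) := by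
  set f : ℕ → (ℕ → K × ZMod N) → ℝ := fun t u =>
    logRatio P s c π χ t (fun r => (u r).1) (fun r => (u r).2)
      - s ^ 2 * informs π P χ (fun r => (u r).1) t with hf
  have hcausal : ∀ t, DependsBelow t (jointKernel A P s c π t) := fun t u v h => by
    funext x
    have e1 : ∀ r < t, (u r).1 = (v r).1 := fun r hr => by rw [h r hr]
    have e2 : ∀ r < t, (u r).2 = (v r).2 := fun r hr => by rw [h r hr]
    unfold jointKernel
    rw [walkKernel_dependsBelow s hπ c t _ _ e2, actKernel_dependsBelow A _ t _ _ e1]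
    rw [actKernel_congr A fun r hr => ?_]
    simp only [envLoss, e2 r hr]
  have hnn : ∀ t u x, 0 ≤ jointKernel A P s c π t u x := fun t u x =>
    mul_nonneg ENNReal.toReal_nonneg (noise_pos _ _).le
  have hone : ∀ t u, ∑ x, jointKernel A P s c π t u x = 1 := fun t u => by
    rw [Fintype.sum_prod_type]
    simp only [jointKernel, ← mul_sum, sum_walkKernel, mul_one, sum_actKernel]
  have hfd : ∀ t, DependsBelow (t + 1) (f t) := fun t u v h => by
    have e1 : ∀ r < t + 1, (u r).1 = (v r).1 := fun r hr => by rw [h r hr]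
    have e2 : ∀ r < t + 1, (u r).2 = (v r).2 := fun r hr => by rw [h r hr]
    have d1 := lastIn_dependsBelow P (t + 1) _ _ e1
    have d2 := (lastIn_dependsBelow P (π t)).mono ((hπ t).trans t.le_succ) _ _ e1
    have d3 := (node_dependsBelow c (π t)).mono ((hπ t).trans t.le_succ) _ _ e2
    simp only at d1 d2 d3
    simp only [hf, logRatio, lowering, informs, d1, d2, d3, h t t.lt_succ_self]
  have hdrift : ∀ t u, ∑ x, jointKernel A P s c π t u x * f t (Function.update u t x) ≤ 0 :=
      fun t u => by
    rw [Fintype.sum_prod_type]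
    refine sum_nonpos fun j _ => ?_
    set b : ℕ → K := fun r => (Function.update u t (j, (0 : ZMod N)) r).1
    have hb : ∀ g, (fun r => (Function.update u t (j, g) r).1) = b := fun g => by
      funext r
      by_cases hr : r = t
      · subst hr; simp [b]
      · simp [b, Function.update_of_ne hr]
    have hnode : ∀ g, node c (fun r => (Function.update u t (j, g) r).2) (π t)
        = node c (fun r => (u r).2) (π t) := fun g =>
      (node_dependsBelow c (π t)) _ _ fun r hr => by
        rw [Function.update_of_ne (by have := hπ t; omega)]
    simp only [hf, jointKernel, logRatio, hb, hnode, Function.update_self, mul_assoc, ← mul_sum]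
    refine mul_nonpos_of_nonneg_of_nonpos ENNReal.toReal_nonneg ?_
    simp only [mul_sub, sum_sub_distrib, ← sum_mul, sum_walkKernel, one_mul]
    rw [← sum_sub_distrib]
    simp only [← mul_sub, walkKernel]
    rw [sub_nonpos]
    by_cases hi : (lastIn P b (t + 1) = some χ ↔ lastIn P b (π t) = some χ)
    · simp [informs, hi, lowering]
    · rw [informs, if_neg hi, mul_one]
      exact relEntropy_noise_le hs0 hs1 (circ_lowering_sub_le P χ b _ _) _
  have key := sum_pathWeight_mul_nonpos hcausal hnn hone hfd hdrift (k₀, 0) T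
  have hsplit : ∀ u, pathWeight (jointKernel A P s c π) T u
      = walkWeight s π c T (fun r => (u r).2)
        * actWeight A (envLoss P none fun r => (u r).2) T (fun r => (u r).1) := fun u => by
    unfold walkWeight actWeight pathWeight
    rw [← prod_mul_distrib]
    exact prod_congr rfl fun t _ => by rw [jointKernel, mul_comm]
  simp only [hsplit, hf] at key
  rw [sum_pad_prod k₀ T (fun b y => walkWeight s π c T y * actWeight A (envLoss P none y) T b
    * ∑ t ∈ range T, (logRatio P s c π χ t b y - s ^ 2 * informs π P χ b t))] at key
  simp only [sum_sub_distrib, mul_sub, ← mul_sum (a := s ^ 2)] at key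
  rw [sub_nonpos] at key
  rw [← mean_smul]
  simp only [mul_assoc] at key
  rwa [mean_eq_sum_sum]

/-- Comparison of the environment with best arm `χ` and the null environment. -/
lemma mean_some_le (hπ : ∀ t, π t ≤ t) (hs0 : 0 ≤ s) (hs1 : s ≤ 1) (χ : K) {F : (ℕ → K) → ℝ}
    (hF0 : ∀ b, 0 ≤ F b) (hF1 : ∀ b, F b ≤ 1) :
    mean A P s π c k₀ T (some χ) F ≤ 3 / 2 * mean A P s π c k₀ T none F
      + 3 * s ^ 2 * mean A P s π c k₀ T none (fun b => ∑ t ∈ range T, informs π P χ b t) := by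
  have hL := mean_logRatio_le A P s c k₀ T hπ hs0 hs1 χ
  have h1 := mean_const A P s c k₀ T hπ (some χ) 1
  have h0 := mean_const A P s c k₀ T hπ none 1
  rw [mean_some_eq A P s c k₀ T hπ χ] at h1 ⊢
  -- After summation the last two terms become `-3` and `3`, as both environments have total mass
  -- one. Only the mean of `F` and the expected log-likelihood ratio remain.
  have hpt : ∀ (w : Fin T → ZMod N) (a : Fin T → K),
      walkWeight s π c T (fun n => pad 0 w n + lowering N P χ (pad k₀ a) (n + 1))
        * (actWeight A (envLoss P none (pad 0 w)) T (pad k₀ a) * F (pad k₀ a))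
      ≤ 3 / 2 * (walkWeight s π c T (pad 0 w)
          * (actWeight A (envLoss P none (pad 0 w)) T (pad k₀ a) * F (pad k₀ a)))
        + 3 * (walkWeight s π c T (pad 0 w)
          * (actWeight A (envLoss P none (pad 0 w)) T (pad k₀ a)
            * ∑ t ∈ range T, logRatio P s c π χ t (pad k₀ a) (pad 0 w)))
        - 3 * (walkWeight s π c T (pad 0 w)
          * (actWeight A (envLoss P none (pad 0 w)) T (pad k₀ a) * 1))
        + 3 * (walkWeight s π c T (fun n => pad 0 w n + lowering N P χ (pad k₀ a) (n + 1))
          * (actWeight A (envLoss P none (pad 0 w)) T (pad k₀ a) * 1)) := fun w a => by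
    rw [walkWeight_lowering]
    have e1 := mul_exp_neg_le (L := ∑ t ∈ range T, logRatio P s c π χ t (pad k₀ a) (pad 0 w))
      (hF0 (pad k₀ a)) (hF1 (pad k₀ a))
    have e2 := mul_nonneg (walkWeight_pos s π c T (pad 0 w)).le
      (actWeight_nonneg A (envLoss P none (pad 0 w)) T (pad k₀ a))
    nlinarith [mul_le_mul_of_nonneg_left e1 e2]
  have hsum := sum_le_sum fun (w : Fin T → ZMod N) (_ : w ∈ univ) =>
    sum_le_sum fun (a : Fin T → K) (_ : a ∈ univ) => hpt w a
  simp only [sum_add_distrib, sum_sub_distrib, ← mul_sum (a := (3 / 2 : ℝ)),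
    ← mul_sum (a := (3 : ℝ))] at hsum
  rw [h1] at hsum
  rw [mean_eq_sum_sum] at h0
  rw [h0, ← mean_eq_sum_sum] at hsum
  linarith

end ChangeOfMeasure

/-! ### Movement cost on padded sequences -/

section MoveCost

variable {K : Type*} [MetricSpace K]

/-- The movement cost of the first `T` actions. -/
noncomputable def moveCost (T : ℕ) (b : ℕ → K) : ℝ := ∑ t ∈ range (T - 1), dist (b (t + 1)) (b t)

lemma movementCost_eq (k₀ : K) {T : ℕ} (a : Fin T → K) :
    movementCost a = moveCost T (pad k₀ a) := by
  unfold movementCost moveCost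
  rw [← Fin.sum_univ_eq_sum_range (fun t => dist (pad k₀ a (t + 1)) (pad k₀ a t))]
  refine sum_congr rfl fun t _ => ?_
  rw [pad_of_lt k₀ a (show (t : ℕ) + 1 < T by omega), pad_of_lt k₀ a (show (t : ℕ) < T by omega)]

end MoveCost

/-! ### Information is paid for by switches, switches by movement -/

section Switching

variable {K : Type*} [DecidableEq K]

/-- The number of times within `T` rounds that the last played point of `P` changes. -/
def switches (P : Finset K) (T : ℕ) (b : ℕ → K) : ℝ :=
  ∑ t ∈ range T, if lastIn P b (t + 1) = lastIn P b t then (0 : ℝ) else 1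

/-- If the status of `χ` differs at the two ends of an edge, it changes in some round in between;
with the parent function `id`, `informs` detects such one-round changes. -/
lemma informs_le_sum (P : Finset K) {π : ℕ → ℕ} (hπ : ∀ t, π t ≤ t) (χ : K) (b : ℕ → K) (t : ℕ) :
    informs π P χ b t ≤ ∑ r ∈ Ico (π t) (t + 1), informs id P χ b r := by
  have hnn : ∀ r, 0 ≤ informs id P χ b r := fun r => by
    unfold informs
    split_ifs <;> norm_num
  by_contra! hlt
  have hzero : ∀ r ∈ Ico (π t) (t + 1), informs id P χ b r = 0 := by
    have h1 : informs π P χ b t ≤ 1 := by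
      unfold informs
      split_ifs <;> norm_num
    intro r hr
    have h2 := (single_le_sum (fun r _ => hnn r) hr).trans_lt (hlt.trans_le h1)
    unfold informs at h2 ⊢
    split_ifs at h2 ⊢ with h3
    · rfl
    · norm_num at h2
  have hiff : ∀ n, π t ≤ n → n ≤ t + 1 →
      (lastIn P b n = some χ ↔ lastIn P b (π t) = some χ) := fun n hn => by
    induction n, hn using Nat.le_induction with
    | base => exact fun _ => Iff.rfl
    | succ n hn ih =>
      intro hn'
      have h3 := hzero n (mem_Ico.2 ⟨hn, hn'⟩)
      unfold informs at h3
      split_ifs at h3 with h4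
      · exact h4.trans (ih (by omega))
      · norm_num at h3
  rw [sum_eq_zero hzero, informs, if_pos (hiff (t + 1) ((hπ t).trans t.le_succ) le_rfl)] at hlt
  exact lt_irrefl _ hlt

/-- A switch changes the status of at most two points, the one left and the one entered. -/
lemma sum_informs_id_le (P : Finset K) (b : ℕ → K) (t : ℕ) :
    ∑ χ ∈ P, informs id P χ b t ≤ 2 * if lastIn P b (t + 1) = lastIn P b t then (0 : ℝ) else 1 := by
  by_cases h : lastIn P b (t + 1) = lastIn P b t
  · simp [informs, h]
  · have hone : ∀ o : Option K, ∑ χ ∈ P, (if o = some χ then (1 : ℝ) else 0) ≤ 1 := fun o => by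
      cases o with
      | none => simp
      | some x =>
        simp only [Option.some.injEq, sum_ite_eq]
        split_ifs <;> norm_num
    rw [if_neg h]
    calc ∑ χ ∈ P, informs id P χ b t
        ≤ ∑ χ ∈ P, ((if lastIn P b (t + 1) = some χ then (1 : ℝ) else 0)
          + if lastIn P b t = some χ then 1 else 0) := sum_le_sum fun χ _ => by
            unfold informs
            simp only [id]
            split_ifs <;> first | (norm_num; done) | (exfalso; tauto)
      _ ≤ 2 * 1 := by
        rw [sum_add_distrib]
        linarith [hone (lastIn P b (t + 1)), hone (lastIn P b t)]

/-- Double counting: a switch in round `r` is charged by every edge spanning `r`, hence at most `J`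
times. -/
lemma sum_informs_le_switches (P : Finset K) {π : ℕ → ℕ} (hπ : ∀ t, π t ≤ t) {T J : ℕ}
    (hwidth : ∀ r, #{t ∈ range T | π t ≤ r ∧ r ≤ t} ≤ J) (b : ℕ → K) :
    ∑ χ ∈ P, ∑ t ∈ range T, informs π P χ b t ≤ 2 * J * switches P T b := by
  set sw : ℕ → ℝ := fun t => if lastIn P b (t + 1) = lastIn P b t then (0 : ℝ) else 1 with hsw
  have hsw0 : ∀ t, 0 ≤ sw t := fun t => by
    simp only [hsw]
    split_ifs <;> norm_num
  calc ∑ χ ∈ P, ∑ t ∈ range T, informs π P χ b t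
      ≤ ∑ χ ∈ P, ∑ t ∈ range T, ∑ r ∈ Ico (π t) (t + 1), informs id P χ b r :=
        sum_le_sum fun χ _ => sum_le_sum fun t _ => informs_le_sum P hπ χ b t
    _ = ∑ χ ∈ P, ∑ r ∈ range T, ∑ t ∈ range T with π t ≤ r ∧ r ≤ t, informs id P χ b r := by
        refine sum_congr rfl fun χ _ => sum_comm' fun t r => ?_
        simp only [mem_range, mem_Ico, mem_filter]
        omega
    _ = ∑ r ∈ range T, #{t ∈ range T | π t ≤ r ∧ r ≤ t} * ∑ χ ∈ P, informs id P χ b r := by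
        rw [sum_comm]
        simp only [sum_const, nsmul_eq_mul, mul_sum]
    _ ≤ ∑ r ∈ range T, J * (2 * sw r) := sum_le_sum fun r _ => by
        refine mul_le_mul (by exact_mod_cast hwidth r) (sum_informs_id_le P b r) ?_ (by positivity)
        exact sum_nonneg fun χ _ => by
          unfold informs
          split_ifs <;> norm_num
    _ = 2 * J * switches P T b := by
        rw [switches, mul_sum]
        exact sum_congr rfl fun r _ => by ring

lemma sum_informs_univ [Fintype K] (T : ℕ) (b : ℕ → K) :
    ∑ χ, ∑ t ∈ range T, informs (fun _ => 0) univ χ b t = T := by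
  rw [sum_comm]
  have : ∀ t, ∑ χ, informs (fun _ => 0) univ χ b t = 1 := fun t => by
    simp [informs, lastIn]
  simp [this]

variable [MetricSpace K]

lemma switches_le_moveCost {P : Finset K} {ε : ℝ} (hε : 0 ≤ ε)
    (hP : ∀ x ∈ P, ∀ y ∈ P, x ≠ y → ε ≤ dist x y) (T : ℕ) (b : ℕ → K) :
    ε * (switches P T b - 1) ≤ moveCost T b := by
  -- The invariant keeps in reserve the distance from the last visited point `x` of `P` to the
  -- current position. By the triangle inequality, excursions outside `P` still pay for the next
  -- switch. The `- 1` is the free first entry into `P`.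
  have key : ∀ t : ℕ, (lastIn P b (t + 1) = none ∧ switches P (t + 1) b = 0)
      ∨ ∃ x ∈ P, lastIn P b (t + 1) = some x
        ∧ ε * (switches P (t + 1) b - 1) + dist x (b t) ≤ moveCost (t + 1) b := fun t => by
    induction t with
    | zero =>
      by_cases h : b 0 ∈ P
      · exact .inr ⟨b 0, h, by simp [lastIn, h], by simp [switches, lastIn, h, moveCost]⟩
      · exact .inl (by simp [lastIn, h, switches])
    | succ t ih =>
      have hs : switches P (t + 1 + 1) b = switches P (t + 1) b
          + if lastIn P b (t + 1 + 1) = lastIn P b (t + 1) then (0 : ℝ) else 1 := sum_range_succ _ _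
      have hm : moveCost (t + 1 + 1) b = moveCost (t + 1) b + dist (b (t + 1)) (b t) :=
        sum_range_succ _ _
      have hm0 : 0 ≤ moveCost (t + 1) b := sum_nonneg fun _ _ => dist_nonneg
      have hd : 0 ≤ dist (b (t + 1)) (b t) := dist_nonneg
      by_cases h : b (t + 1) ∈ P
      · have hl : lastIn P b (t + 1 + 1) = some (b (t + 1)) := by rw [lastIn, if_pos h]
        refine .inr ⟨b (t + 1), h, hl, ?_⟩
        rw [hs, hm, hl, dist_self]
        rcases ih with ⟨h1, h2⟩ | ⟨x, hx, h1, h2⟩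
        · simp only [h1, h2, reduceCtorEq, if_false]
          linarith
        · rw [h1]
          have h3 := dist_triangle_right x (b (t + 1)) (b t)
          split_ifs with h4
          · linarith [dist_nonneg (x := x) (y := b t)]
          · have := hP x hx _ h fun h5 => h4 (by rw [h5])
            linarith
      · have hl : lastIn P b (t + 1 + 1) = lastIn P b (t + 1) := by
          conv_lhs => rw [lastIn]
          rw [if_neg h]
        rw [hs, hm, hl, if_pos rfl, add_zero]
        rcases ih with h1 | ⟨x, hx, h1, h2⟩
        · exact .inl h1
        · refine .inr ⟨x, hx, h1, ?_⟩
          have h3 := dist_triangle x (b t) (b (t + 1))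
          rw [dist_comm (b t)] at h3
          linarith
  cases T with
  | zero => simp [switches, moveCost, hε]
  | succ t =>
    rcases key t with ⟨-, h⟩ | ⟨x, -, -, h⟩
    · have : 0 ≤ moveCost (t + 1) b := sum_nonneg fun _ _ => dist_nonneg
      rw [h]
      linarith
    · linarith [dist_nonneg (x := x) (y := b t)]

end Switching

/-! ### Regret bounds in the random environments -/

section Regret

/-- The gap is one step of the cycle, except at `y t = 0`, where the lowered height wraps to `N - 1`
and the best arm looks worst; the subtracted `1` absorbs this. -/
lemma envLoss_sub_ge {K : Type*} [DecidableEq K] {N : ℕ} [NeZero N] (P : Finset K)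
    {χ : K} (hχ : χ ∈ P) (y : ℕ → ZMod N) (t : ℕ) (j : K) :
    1 / N - (if j = χ then 1 else 0) / N - (if y t = 0 then (1 : ℝ) else 0)
      ≤ envLoss P (some χ) y t j - envLoss P (some χ) y t χ := by
  have hN : (0 : ℝ) < N := by exact_mod_cast Nat.pos_of_ne_zero (NeZero.ne N)
  by_cases hj : j = χ
  · have : (0 : ℝ) ≤ if y t = 0 then (1 : ℝ) else 0 := by positivity
    rw [if_pos hj, hj, sub_self, sub_self]
    linarith
  rw [if_neg hj, zero_div, sub_zero]
  have hbest : envLoss P (some χ) y t χ = ((y t - 1).val : ℝ) / N := by simp [envLoss, hχ]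
  have hlt : ((y t - 1).val : ℝ) + 1 ≤ N := by exact_mod_cast ZMod.val_lt (y t - 1)
  split_ifs with h0
  · have h1 := (envLoss_mem_Icc P (some χ) y t j).1
    rw [hbest]
    have h2 : 1 / (N : ℝ) - 1 ≤ - (((y t - 1).val : ℝ) / N) := by
      rw [div_sub_one hN.ne', ← neg_div]
      gcongr
      linarith
    linarith
  · rw [hbest, sub_zero]
    by_cases hjP : j ∈ P
    · have h1 : 1 ≤ (y t).val := Nat.one_le_iff_ne_zero.2 (by rwa [Ne, ZMod.val_eq_zero])
      have hN1 : N ≠ 1 := fun h => by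
        have := ZMod.val_lt (y t)
        omega
      have h2 : (y t - 1).val + 1 = (y t).val := by
        have hone : (1 : ZMod N).val = 1 := by
          rw [ZMod.val_one_eq_one_mod, Nat.mod_eq_of_lt]
          have := NeZero.ne N
          omega
        rw [ZMod.val_sub (by rwa [hone]), hone]
        omega
      have h3 : envLoss P (some χ) y t j = ((y t).val : ℝ) / N := by
        simp [envLoss, hjP, Ne.symm hj]
      rw [h3, ← h2]
      push_cast
      apply le_of_eq
      ring
    · have h3 : envLoss P (some χ) y t j = 1 := by simp [envLoss, hjP]
      rw [h3, one_sub_div hN.ne']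
      gcongr
      linarith

variable {K : Type*} [Fintype K] [MetricSpace K]

/-- Lower bound for the regret by comparison with a fixed action. -/
lemma sum_actWeight_le_movementRegret (A : Algorithm K) (ℓ : ℕ → K → ℝ) (k₀ : K) (T : ℕ) (i : K)
    (G : (ℕ → K) → ℝ)
    (hG : ∀ b, G b ≤ ∑ t ∈ range T, (ℓ t (b t) - ℓ t i) + moveCost T b) :
    ∑ a : Fin T → K, actWeight A ℓ T (pad k₀ a) * G (pad k₀ a)
      ≤ movementRegret A (fun t : Fin T => ℓ t) := by
  have hinf : ⨅ i : K, ∑ t : Fin T, ℓ t i ≤ ∑ t : Fin T, ℓ t i :=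
    ciInf_le (Set.finite_range _).bddBelow i
  unfold movementRegret
  have hle : ∑ a : Fin T → K, actWeight A ℓ T (pad k₀ a) * G (pad k₀ a)
      ≤ ∑ a : Fin T → K, actWeight A ℓ T (pad k₀ a)
        * ((∑ t : Fin T, ℓ t (a t) + movementCost a) - ∑ t : Fin T, ℓ t i) :=
    sum_le_sum fun a _ => mul_le_mul_of_nonneg_left (by
      refine (hG _).trans (le_of_eq ?_)
      rw [movementCost_eq k₀, sum_sub_distrib, ← Fin.sum_univ_eq_sum_range,
        ← Fin.sum_univ_eq_sum_range (fun t => ℓ t i)]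
      simp only [pad_val]
      ring) (actWeight_nonneg _ _ _ _)
  simp only [mul_sub, sum_sub_distrib, ← sum_mul, sum_actWeight, one_mul] at hle
  simp only [actionProb_eq A ℓ k₀]
  linarith

lemma exists_le_of_weighted_sum {ι : Type*} [Fintype ι] {μ R : ι → ℝ} (h0 : ∀ i, 0 < μ i)
    (h1 : ∑ i, μ i = 1) : ∃ i, ∑ j, μ j * R j ≤ R i := by
  by_contra! h
  have hne : (univ : Finset ι).Nonempty := by
    by_contra hne
    rw [not_nonempty_iff_eq_empty.1 hne] at h1
    simp at h1
  have := sum_lt_sum_of_nonempty hne fun i _ => mul_lt_mul_of_pos_left (h i) (h0 i)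
  rw [← sum_mul, h1, one_mul] at this
  exact lt_irrefl _ this

variable [DecidableEq K] {N : ℕ} [NeZero N] (A : Algorithm K) (P : Finset K) (s : ℝ)
  {π : ℕ → ℕ} (c : ZMod N) (k₀ : K) (T : ℕ)

/-- Without a best arm the regret is at least the movement cost. -/
lemma exists_mean_moveCost_le (hπ : ∀ t, π t ≤ t) (hP : P.Nonempty) :
    ∃ w : Fin T → ZMod N, mean A P s π c k₀ T none (moveCost T)
      ≤ movementRegret A (fun t : Fin T => envLoss P none (pad 0 w) t) := by
  obtain ⟨i, hi⟩ := hP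
  obtain ⟨w, hw⟩ := exists_le_of_weighted_sum
    (R := fun w => movementRegret A (fun t : Fin T => envLoss P none (pad 0 w) t))
    (fun w : Fin T → ZMod N => walkWeight_pos s π c T (pad 0 w)) (sum_walkWeight s hπ c T)
  refine ⟨w, le_trans (sum_le_sum fun w _ => ?_) hw⟩
  refine mul_le_mul_of_nonneg_left ?_ (walkWeight_pos _ _ _ _ _).le
  refine sum_actWeight_le_movementRegret A _ k₀ T i _ fun b => ?_
  have : 0 ≤ ∑ t ∈ range T, (envLoss P none (pad 0 w) t (b t) - envLoss P none (pad 0 w) t i) := by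
    refine sum_nonneg fun t _ => ?_
    rw [sub_nonneg]
    by_cases hb : b t ∈ P
    · simp [envLoss, hb, hi]
    · exact (envLoss_mem_Icc _ _ _ _ _).2.trans (by simp [envLoss, hb])
  linarith

/-- With best arm `χ` the regret is proportional to the number of rounds not played at `χ`. -/
lemma exists_mean_count_le {dep : ℕ → ℕ} (hπ : ∀ t, π t ≤ t) (hs0 : 0 ≤ s) {J m : ℕ}
    (hdep : ∀ t < T, dep (π t) + 1 ≤ dep (t + 1)) (hJ : ∀ n ≤ T, dep n ≤ J)
    (hm : 0 < m) (hJ0 : 0 < J) (hc : circ c = J * m) {χ : K} (hχ : χ ∈ P) :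
    ∃ w : Fin T → ZMod N,
      T / N - mean A P s π c k₀ T (some χ) (fun b => ∑ t ∈ range T, if b t = χ then 1 else 0) / N
        - T * (T * (N * Real.exp (-s * m)))
      ≤ movementRegret A (fun t : Fin T => envLoss P (some χ) (pad 0 w) t) := by
  obtain ⟨w, hw⟩ := exists_le_of_weighted_sum
    (R := fun w => movementRegret A (fun t : Fin T => envLoss P (some χ) (pad 0 w) t))
    (fun w : Fin T → ZMod N => walkWeight_pos s π c T (pad 0 w)) (sum_walkWeight s hπ c T)
  refine ⟨w, le_trans ?_ hw⟩
  have hstep : ∀ w : Fin T → ZMod N,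
      T / N - (∑ a : Fin T → K, actWeight A (envLoss P (some χ) (pad 0 w)) T (pad k₀ a)
          * ∑ t ∈ range T, if pad k₀ a t = χ then 1 else 0) / N
        - ∑ t ∈ range T, (if pad 0 w t = 0 then (1 : ℝ) else 0)
      ≤ movementRegret A (fun t : Fin T => envLoss P (some χ) (pad 0 w) t) := fun w => by
    have h1 := sum_actWeight_le_movementRegret A (envLoss P (some χ) (pad 0 w)) k₀ T χ
      (fun b => T / N - (∑ t ∈ range T, if b t = χ then 1 else 0) / N
        - ∑ t ∈ range T, (if pad 0 w t = 0 then (1 : ℝ) else 0)) fun b => by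
        have h2 := sum_le_sum fun t (_ : t ∈ range T) => envLoss_sub_ge P hχ (pad 0 w) t (b t)
        have h3 : 0 ≤ moveCost T b := sum_nonneg fun _ _ => dist_nonneg
        rw [sum_sub_distrib, sum_sub_distrib, ← sum_div, ← sum_div, sum_const, card_range,
          nsmul_eq_mul, mul_one] at h2
        linarith
    refine le_trans (le_of_eq ?_) h1
    simp only [mul_sub, sum_sub_distrib, ← sum_mul, sum_actWeight, one_mul, ← mul_div_assoc,
      ← sum_div]
  refine le_trans ?_ (sum_le_sum fun w _ =>
    mul_le_mul_of_nonneg_left (hstep w) (walkWeight_pos s π c T _).le)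
  have hhit : ∑ w : Fin T → ZMod N, walkWeight s π c T (pad 0 w)
      * ∑ t ∈ range T, (if pad 0 w t = 0 then (1 : ℝ) else 0)
      ≤ T * (T * (N * Real.exp (-s * m))) := by
    simp only [mul_sum]
    rw [sum_comm]
    refine (sum_le_sum fun t ht => sum_walkWeight_hit_zero_le hs0 hπ hdep hJ hm hJ0 hc
      (mem_range.1 ht)).trans (le_of_eq ?_)
    simp only [sum_const, card_range, nsmul_eq_mul]
  simp only [mul_sub, sum_sub_distrib, ← sum_mul, sum_walkWeight s hπ, one_mul, ← mul_div_assoc,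
    ← sum_div]
  unfold mean
  linarith

/-- If little information is gathered in the null environment, then some arm can be made best
so that the regret is linear in `T / N`. -/
lemma exists_movementRegret_ge {dep : ℕ → ℕ} (hπ : ∀ t, π t ≤ t) (hs0 : 0 ≤ s) (hs1 : s ≤ 1)
    {J m : ℕ} (hdep : ∀ t < T, dep (π t) + 1 ≤ dep (t + 1)) (hJ : ∀ n ≤ T, dep n ≤ J)
    (hm : 0 < m) (hJ0 : 0 < J) (hc : circ c = J * m) (hT : 0 < T) (hP : 2 ≤ #P)
    (hinfo : 48 * s ^ 2 * mean A P s π c k₀ T none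
      (fun b => ∑ χ ∈ P, ∑ t ∈ range T, informs π P χ b t) ≤ #P)
    (htail : 16 * T * N ^ 2 * Real.exp (-s * m) ≤ 1) :
    ∃ χ ∈ P, ∃ w : Fin T → ZMod N, (T : ℝ) / (8 * N)
      ≤ movementRegret A (fun t : Fin T => envLoss P (some χ) (pad 0 w) t) := by
  have hT' : (0 : ℝ) < T := by exact_mod_cast hT
  have hN : (0 : ℝ) < N := by exact_mod_cast Nat.pos_of_ne_zero (NeZero.ne N)
  have hP' : (2 : ℝ) ≤ #P := by exact_mod_cast hP
  set cnt : K → (ℕ → K) → ℝ := fun χ b => ∑ t ∈ range T, if b t = χ then (1 : ℝ) else 0 with hcnt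
  have hc0 : ∀ χ b, 0 ≤ cnt χ b := fun χ b => sum_nonneg fun t _ => by split_ifs <;> norm_num
  have hcT : ∀ χ b, cnt χ b ≤ T := fun χ b => by
    refine (sum_le_sum (g := fun _ => (1 : ℝ)) fun t _ => ?_).trans (by simp)
    split_ifs <;> norm_num
  have hcP : ∀ b, ∑ χ ∈ P, cnt χ b ≤ T := fun b => by
    rw [sum_comm]
    refine (sum_le_sum (g := fun _ => (1 : ℝ)) fun t _ => ?_).trans (by simp)
    rw [sum_ite_eq]
    split_ifs <;> norm_num
  have hχ : ∀ χ, mean A P s π c k₀ T (some χ) (cnt χ) ≤ 3 / 2 * mean A P s π c k₀ T none (cnt χ)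
      + T * (3 * s ^ 2 * mean A P s π c k₀ T none (fun b => ∑ t ∈ range T, informs π P χ b t)) :=
      fun χ => by
    have h1 := mean_some_le A P s c k₀ T hπ hs0 hs1 χ (F := fun b => (T : ℝ)⁻¹ * cnt χ b)
      (fun b => mul_nonneg (by positivity) (hc0 χ b))
      (fun b => by rw [inv_mul_le_one₀ hT']; exact hcT χ b)
    rw [mean_smul, mean_smul, inv_mul_le_iff₀ hT'] at h1
    refine h1.trans (le_of_eq ?_)
    field_simp
  -- Per arm, `13 / 16 = 3 / 4 + 1 / 16`: the plays sum to at most `T` and `2 ≤ #P`, so `3 / 2` of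
  -- their average is at most `3 / 4 * T`; `hinfo` bounds the information term by `T / 16`. The tail
  -- takes another `1 / 16`, which leaves `1 / 8`.
  have hsum : ∑ χ ∈ P, mean A P s π c k₀ T (some χ) (cnt χ)
      ≤ ∑ _χ ∈ P, 13 / 16 * (T : ℝ) := by
    refine (sum_le_sum fun χ _ => hχ χ).trans ?_
    rw [sum_add_distrib, ← mul_sum, ← mul_sum, ← mul_sum, ← mean_sum, ← mean_sum, sum_const,
      nsmul_eq_mul]
    have h1 := mean_mono A P s π c k₀ T none hcP
    rw [mean_const A P s c k₀ T hπ] at h1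
    nlinarith [mul_le_mul_of_nonneg_left hinfo hT'.le]
  obtain ⟨χ, hχP, hle⟩ := exists_le_of_sum_le (card_pos.1 (by omega)) hsum
  obtain ⟨w, hw⟩ := exists_mean_count_le A P s c k₀ T hπ hs0 hdep hJ hm hJ0 hc hχP
  refine ⟨χ, hχP, w, le_trans ?_ hw⟩
  have h2 : T * (T * (N * Real.exp (-s * m))) ≤ T / (16 * N) := by
    rw [le_div_iff₀ (by positivity)]
    nlinarith [mul_le_mul_of_nonneg_left htail hT'.le]
  have h3 : mean A P s π c k₀ T (some χ) (cnt χ) / N ≤ 13 / 16 * T / N := by gcongr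
  have h4 : (T : ℝ) / (8 * N) = T / N - 13 / 16 * T / N - T / (16 * N) := by
    field_simp
    norm_num
  linarith

end Regret

/-! ### Packings that nearly attain the complexity -/

section Packing

variable {K : Type*} [MetricSpace K]

lemma le_dist_of_isPacking {ε : ℝ} (hε : 0 ≤ ε) {P : Set K} (hP : IsPacking ε P) {x y : K}
    (hx : x ∈ P) (hy : y ∈ P) (hxy : x ≠ y) : ε ≤ dist x y := by
  by_contra! h
  exact Set.disjoint_left.1 (hP hx hy hxy) (Metric.mem_closedBall_self hε)
    (Metric.mem_closedBall.2 h.le)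

variable [Fintype K]

lemma bddAbove_card_packing (ε : ℝ) :
    BddAbove {n : ℕ | ∃ P : Finset K, IsPacking ε (P : Set K) ∧ #P = n} :=
  ⟨Fintype.card K, by rintro _ ⟨P, -, rfl⟩; exact card_le_univ P⟩

lemma exists_card_eq_packingNumber (ε : ℝ) :
    ∃ P : Finset K, IsPacking ε (P : Set K) ∧ #P = packingNumber K ε :=
  Nat.sSup_mem (s := {n : ℕ | ∃ P : Finset K, IsPacking ε (P : Set K) ∧ #P = n})
    ⟨0, ∅, by simp [IsPacking], rfl⟩ (bddAbove_card_packing ε)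

lemma packingNumber_le_card (ε : ℝ) : packingNumber K ε ≤ Fintype.card K := by
  obtain ⟨P, -, h⟩ := exists_card_eq_packingNumber (K := K) ε
  exact h ▸ card_le_univ P

lemma two_le_packingNumber (h : 1 ≤ Metric.diam (Set.univ : Set K)) :
    2 ≤ packingNumber K (1 / 4) := by
  classical
  obtain ⟨x, y, hxy⟩ : ∃ x y : K, 1 / 2 < dist x y := by
    by_contra! hle
    have := Metric.diam_le_of_forall_dist_le (s := (Set.univ : Set K)) (C := 1 / 2) (by norm_num)
      fun x _ y _ => hle x y
    linarith
  have hne : x ≠ y := fun h => by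
    rw [h, dist_self] at hxy
    linarith
  refine le_csSup (bddAbove_card_packing _) ⟨{x, y}, ?_, card_pair hne⟩
  unfold IsPacking
  have : Std.Symm (Function.onFun Disjoint fun i : K => Metric.closedBall i (1 / 4 : ℝ)) :=
    ⟨fun _ _ h => h.symm⟩
  rw [coe_pair, Set.PairwiseDisjoint, Set.pairwise_pair_of_symm]
  refine fun _ => Set.disjoint_left.2 fun z hz hz' => ?_
  rw [Metric.mem_closedBall] at hz hz'
  linarith [dist_triangle_left x y z]

/-- If the complexity is at most `2`, two distant points with `ε = 1 / 4` suffice. Otherwise a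
nearly optimal `ε` has product above `1`, and `ε < 1` forces at least two points. -/
lemma exists_packingComplexity_le (h : 1 ≤ Metric.diam (Set.univ : Set K)) :
    ∃ ε : ℝ, 0 < ε ∧ ε < 1 ∧ 2 ≤ packingNumber K ε ∧ 1 / 2 ≤ ε * packingNumber K ε ∧
      packingComplexity K ≤ 4 * (ε * packingNumber K ε) := by
  rcases le_or_gt (packingComplexity K) 2 with hC | hC
  · have h2 := two_le_packingNumber h
    have h2' : (2 : ℝ) ≤ packingNumber K (1 / 4) := by exact_mod_cast h2
    exact ⟨1 / 4, by norm_num, by norm_num, h2, by linarith, by linarith⟩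
  · obtain ⟨_, ⟨ε, hε, rfl⟩, hlt⟩ := exists_lt_of_lt_csSup
      (s := (fun ε : ℝ => ε * (packingNumber K ε : ℝ)) '' Set.Ioo 0 1)
      ⟨_, 1 / 2, by norm_num, rfl⟩ (show packingComplexity K / 2 < _ from half_lt_self (by linarith))
    simp only at hlt
    refine ⟨ε, hε.1, hε.2, ?_, by linarith, by linarith⟩
    by_contra! h1
    have h1' : (packingNumber K ε : ℝ) ≤ 1 := by exact_mod_cast Nat.le_of_lt_succ h1
    nlinarith [hε.1, hε.2]

end Packing

/-! ### Choice of parameters and conclusion -/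

section LowerBound

lemma circ_half {J m : ℕ} (h : 0 < J * m) :
    circ (((J * m : ℕ) : ZMod (2 * (J * m)))) = J * m := by
  have : NeZero (2 * (J * m)) := ⟨by omega⟩
  rw [circ, ZMod.valMinAbs_natAbs_eq_min, ZMod.val_natCast, Nat.mod_eq_of_lt (by omega)]
  omega

/-- The cycle length that makes visits of the walk to the opposite point negligible. -/
lemma exists_cycle_length {T J : ℕ} (hJ : 2 ≤ J) (hTJ : T < 2 ^ J) {s : ℝ} (hs0 : 0 < s)
    (hs1 : s ≤ 1) (hsT : 1 / s ≤ 16 * J * T) :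
    ∃ m : ℕ, 0 < m ∧ (2 * (J * m) : ℕ) ≤ 66 * (J : ℝ) ^ 2 / s ∧
      16 * T * ((2 * (J * m) : ℕ) : ℝ) ^ 2 * Real.exp (-s * m) ≤ 1 := by
  have hJ' : (2 : ℝ) ≤ J := by exact_mod_cast hJ
  have hm1 := Nat.le_ceil (32 * (J : ℝ) / s)
  have hm2 := Nat.ceil_lt_add_one (show 0 ≤ 32 * (J : ℝ) / s by positivity)
  set m := ⌈32 * (J : ℝ) / s⌉₊
  -- The choice of `m` gives `s * m ≥ 32 * J`, so the exponential beats the polynomial prefactor,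
  -- which is at most `2 ^ (22 * J)`.
  have hm3 : (m : ℝ) ≤ 33 * J / s := by
    have : 1 ≤ (J : ℝ) / s := by rw [le_div_iff₀ hs0]; linarith
    have e : 33 * (J : ℝ) / s = 32 * J / s + J / s := by ring
    linarith
  have hN : ((2 * (J * m) : ℕ) : ℝ) ≤ 66 * (J : ℝ) ^ 2 / s := by
    push_cast
    calc 2 * ((J : ℝ) * m) ≤ 2 * (J * (33 * J / s)) := by gcongr
      _ = _ := by ring
  refine ⟨m, Nat.ceil_pos.2 (by positivity), hN, ?_⟩
  have hJ2 : (J : ℝ) ≤ 2 ^ J := by exact_mod_cast Nat.lt_two_pow_self.le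
  have hT2 : (T : ℝ) ≤ 2 ^ J := by exact_mod_cast hTJ.le
  have hN2 : ((2 * (J * m) : ℕ) : ℝ) ≤ 1056 * (J : ℝ) ^ 3 * T := by
    refine hN.trans ?_
    calc 66 * (J : ℝ) ^ 2 / s = 66 * (J : ℝ) ^ 2 * (1 / s) := by ring
      _ ≤ 66 * (J : ℝ) ^ 2 * (16 * J * T) := by gcongr
      _ = _ := by ring
  have hexp : (2 : ℝ) ^ (32 * J) ≤ Real.exp (s * m) := by
    have h1 : 32 * (J : ℝ) ≤ s * m := by
      rw [div_le_iff₀ hs0] at hm1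
      linarith
    refine le_trans ?_ (Real.exp_le_exp.2 h1)
    have h2 : (2 : ℝ) ≤ Real.exp 1 := by linarith [Real.add_one_le_exp (1 : ℝ)]
    calc (2 : ℝ) ^ (32 * J) ≤ Real.exp 1 ^ (32 * J) := by gcongr
      _ = _ := by rw [← Real.exp_nat_mul]; push_cast; ring_nf
  have hpoly : 16 * T * ((2 * (J * m) : ℕ) : ℝ) ^ 2 ≤ 2 ^ (32 * J) := by
    have h25 : (16 * 1056 ^ 2 : ℝ) ≤ (2 ^ J) ^ 13 := by
      calc (16 * 1056 ^ 2 : ℝ) ≤ (2 ^ 2) ^ 13 := by norm_num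
        _ ≤ (2 ^ J) ^ 13 := by gcongr; norm_num
    calc 16 * T * ((2 * (J * m) : ℕ) : ℝ) ^ 2 ≤ 16 * T * (1056 * (J : ℝ) ^ 3 * T) ^ 2 := by gcongr
      _ = (16 * 1056 ^ 2) * (J : ℝ) ^ 6 * (T : ℝ) ^ 3 := by ring
      _ ≤ (2 ^ J) ^ 13 * (2 ^ J) ^ 6 * (2 ^ J) ^ 3 := by gcongr
      _ = 2 ^ (22 * J) := by rw [← pow_add, ← pow_add, ← pow_mul, mul_comm J]
      _ ≤ 2 ^ (32 * J) := by
        gcongr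
        · norm_num
        · norm_num
  rw [neg_mul, Real.exp_neg, ← div_eq_mul_inv, div_le_one (Real.exp_pos _)]
  exact hpoly.trans hexp

variable {K : Type*} [Fintype K] [DecidableEq K] [MetricSpace K]

/-- The lower bound in terms of a trade-off between information and movement. -/
lemma exists_loss_of_informs_le (A : Algorithm K) {P : Finset K} (hP : 2 ≤ #P) {π dep : ℕ → ℕ}
    (hπ : ∀ t, π t ≤ t) {T J : ℕ} (hJ : 2 ≤ J) (hT : 0 < T) (hTJ : T < 2 ^ J)
    (hdep : ∀ t < T, dep (π t) + 1 ≤ dep (t + 1)) (hdepJ : ∀ n ≤ T, dep n ≤ J)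
    {s : ℝ} (hs0 : 0 < s) (hs1 : s ≤ 1) (hsT : 1 / s ≤ 16 * J * T) {α β V : ℝ} (hα : 0 ≤ α)
    (hinfo : ∀ b : ℕ → K, ∑ χ ∈ P, ∑ t ∈ range T, informs π P χ b t ≤ α * moveCost T b + β)
    (hV : 48 * s ^ 2 * (α * V + β) ≤ #P) :
    ∃ ℓ : Fin T → K → ℝ, (∀ t i, ℓ t i ∈ Set.Icc (0 : ℝ) 1) ∧
      min V (T * s / (528 * J ^ 2)) ≤ movementRegret A ℓ := by
  obtain ⟨m, hm, hN, htail⟩ := exists_cycle_length hJ hTJ hs0 hs1 hsT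
  have hJm : 0 < J * m := Nat.mul_pos (by omega) hm
  have : NeZero (2 * (J * m)) := ⟨by omega⟩
  obtain ⟨k₀, hk₀⟩ := card_pos.1 (show 0 < #P by omega)
  set c : ZMod (2 * (J * m)) := ((J * m : ℕ) : ZMod (2 * (J * m)))
  -- Either the null environment already costs `V` in movement, or `hinfo` and `hV` make the
  -- information scarce enough to hide a best arm.
  rcases le_or_gt V (mean A P s π c k₀ T none (moveCost T)) with hle | hlt
  · obtain ⟨w, hw⟩ := exists_mean_moveCost_le A P s c k₀ T hπ ⟨k₀, hk₀⟩
    exact ⟨_, fun t i => envLoss_mem_Icc _ _ _ _ _, (min_le_left _ _).trans (hle.trans hw)⟩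
  · have hI := mean_mono A P s π c k₀ T none hinfo
    rw [mean_add, mean_smul, mean_const A P s c k₀ T hπ] at hI
    obtain ⟨χ, -, w, hw⟩ := exists_movementRegret_ge A P s c k₀ T hπ hs0.le hs1 hdep hdepJ hm
      (by omega) (circ_half hJm) hT hP (le_trans (by gcongr; nlinarith) hV) htail
    refine ⟨_, fun t i => envLoss_mem_Icc _ _ _ _ _, (min_le_right _ _).trans (le_trans ?_ hw)⟩
    have hJ' : (2 : ℝ) ≤ J := by exact_mod_cast hJ
    have hN0 : (0 : ℝ) < ((2 * (J * m) : ℕ) : ℝ) := by exact_mod_cast (by omega : 0 < 2 * (J * m))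
    rw [le_div_iff₀ hs0] at hN
    rw [div_le_div_iff₀ (by positivity) (by positivity)]
    have : (0 : ℝ) < T := by exact_mod_cast hT
    nlinarith

/-- The lower bound coming from the number of actions. -/
lemma exists_loss_sqrt_le (A : Algorithm K) {T J : ℕ} (hJ : 2 ≤ J) (hTJ : T < 2 ^ J)
    (hK : 2 ≤ Fintype.card K) (hKT : Fintype.card K ≤ T) :
    ∃ ℓ : Fin T → K → ℝ, (∀ t i, ℓ t i ∈ Set.Icc (0 : ℝ) 1) ∧
      √((Fintype.card K : ℝ) * T) / (3696 * J ^ 2) ≤ movementRegret A ℓ := by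
  have hK' : (2 : ℝ) ≤ Fintype.card K := by exact_mod_cast hK
  have hKT' : (Fintype.card K : ℝ) ≤ T := by exact_mod_cast hKT
  have hJ' : (2 : ℝ) ≤ J := by exact_mod_cast hJ
  set k : ℝ := (Fintype.card K : ℝ)
  have hT0 : (0 : ℝ) < T := by linarith
  -- This solves `48 * s ^ 2 * T = k`, the information budget of the star, which reveals one arm per
  -- round.
  set s : ℝ := √(k / (48 * T)) with hs
  have hs0 : 0 < s := Real.sqrt_pos.2 (by positivity)
  have hs2 : s ^ 2 = k / (48 * T) := Real.sq_sqrt (by positivity)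
  have hs1 : s ≤ 1 := by
    refine Real.sqrt_le_one.2 ?_
    rw [div_le_one (by positivity)]
    linarith
  have hsT : 1 / s ≤ 16 * J * T := by
    rw [div_le_iff₀ hs0]
    refine (one_le_sq_iff₀ (by positivity)).1 ?_
    rw [mul_pow, hs2, mul_pow, mul_pow]
    have e : (16 : ℝ) ^ 2 * J ^ 2 * T ^ 2 * (k / (48 * T)) = 16 / 3 * (J ^ 2 * T * k) := by
      field_simp
      norm_num
    rw [e]
    nlinarith [mul_le_mul (mul_le_mul hJ' hJ' (by norm_num) (by positivity)) (mul_le_mul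
      (hK'.trans hKT') hK' (by norm_num) (by positivity)) (by norm_num) (by positivity)]
  -- Information needs no movement here, so `α = 0` and `V` is free; it is set equal to the other
  -- term of the minimum.
  obtain ⟨ℓ, h01, hℓ⟩ := exists_loss_of_informs_le A (P := univ) (by simpa using hK)
    (π := fun _ => 0) (dep := fun n => if n = 0 then 0 else 1) (fun t => t.zero_le) hJ
    (by exact_mod_cast hT0) hTJ (by simp) (fun n _ => by split_ifs <;> omega) hs0 hs1 hsT
    (α := 0) (β := T) (V := T * s / (528 * J ^ 2)) le_rfl
    (fun b => by rw [sum_informs_univ]; linarith)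
    (by
      rw [hs2, card_univ]
      apply le_of_eq
      field_simp
      ring)
  refine ⟨ℓ, h01, le_trans ?_ hℓ⟩
  rw [min_self]
  have h7 : √(k * T) ≤ 7 * (T * s) := by
    refine Real.sqrt_le_iff.2 ⟨by positivity, ?_⟩
    rw [mul_pow, mul_pow, hs2]
    have e : (7 : ℝ) ^ 2 * (T ^ 2 * (k / (48 * T))) = 49 / 48 * (k * T) := by
      field_simp
      norm_num
    rw [e]
    nlinarith
  rw [div_le_div_iff₀ (by positivity) (by positivity)]
  nlinarith [sq_nonneg (J : ℝ)]

/-- The lower bound coming from a packing. -/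
lemma exists_loss_packing_le (A : Algorithm K) {T J : ℕ} (hJ : 2 ≤ J) (hTJ : T < 2 ^ J)
    (hT : 2 ≤ T) {P : Finset K} (hP : 2 ≤ #P) (hPT : #P ≤ T) {ε : ℝ} (hε0 : 0 < ε) (hε1 : ε < 1)
    (hdist : ∀ x ∈ P, ∀ y ∈ P, x ≠ y → ε ≤ dist x y) (hεP : 1 / 2 ≤ ε * #P) :
    ∃ ℓ : Fin T → K → ℝ, (∀ t i, ℓ t i ∈ Set.Icc (0 : ℝ) 1) ∧
      T * (ε * #P / T) ^ (1 / 3 : ℝ) / (7392 * J ^ 3) ≤ movementRegret A ℓ := by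
  have hP' : (2 : ℝ) ≤ #P := by exact_mod_cast hP
  have hPT' : (#P : ℝ) ≤ T := by exact_mod_cast hPT
  have hJ' : (2 : ℝ) ≤ J := by exact_mod_cast hJ
  set n : ℝ := (#P : ℝ)
  have hT0 : (2 : ℝ) ≤ T := by exact_mod_cast hT
  have hx0 : 0 < ε * n / T := by positivity
  have hx1 : ε * n / T ≤ 1 := by
    rw [div_le_one (by positivity)]
    nlinarith
  set q : ℝ := (ε * n / T) ^ (1 / 3 : ℝ) with hq
  have hq0 : 0 < q := Real.rpow_pos_of_pos hx0 _
  have hq1 : q ≤ 1 := Real.rpow_le_one hx0.le hx1 (by norm_num)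
  have hq3 : q ^ 3 = ε * n / T := by
    rw [hq, ← Real.rpow_natCast, ← Real.rpow_mul hx0.le]
    norm_num
  have hqT : 7 / 8 ≤ q * T := by
    by_contra! hlt
    have h1 : (q * T) ^ 3 < (7 / 8) ^ 3 := by gcongr
    rw [mul_pow, hq3] at h1
    have e : ε * n / T * (T : ℝ) ^ 3 = ε * n * T ^ 2 := by field_simp
    rw [e] at h1
    nlinarith
  -- The factor `14` satisfies `14 ^ 2 ≥ 2 * 96`, so `n / (96 * J * s ^ 2)` is at least `2 * n / q ^
  -- 2`; half of this pays for the `- 1` in `V` below, which is the value that makes `hV` an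
  -- equality.
  set s : ℝ := q / (14 * J) with hs
  have hs0 : 0 < s := by positivity
  have hs1 : s ≤ 1 := by
    rw [hs, div_le_one (by positivity)]
    linarith
  have hsT : 1 / s ≤ 16 * J * T := by
    rw [hs, one_div_div, div_le_iff₀ hq0]
    nlinarith
  obtain ⟨ℓ, h01, hℓ⟩ := exists_loss_of_informs_le A hP multiscale_le
    (dep := multiscaleDepth J) hJ (by omega) hTJ (fun t ht => multiscaleDepth_parent (by omega))
    (fun n _ => multiscaleDepth_le J n) hs0 hs1 hsT
    (α := 2 * J / ε) (β := 2 * J) (V := ε * (n / (96 * J * s ^ 2) - 1)) (by positivity)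
    (fun b => by
      have h1 := sum_informs_le_switches P multiscale_le (multiscale_width hTJ) b
      have h2 := switches_le_moveCost hε0.le hdist T b
      rw [← le_div_iff₀' hε0] at h2
      refine h1.trans ?_
      have e : 2 * (J : ℝ) / ε * moveCost T b = 2 * J * (moveCost T b / ε) := by ring
      rw [e]
      nlinarith)
    (by
      apply le_of_eq
      field_simp
      ring)
  refine ⟨ℓ, h01, le_trans (le_min ?_ ?_) hℓ⟩
  · have h1 : 2 * n / q ^ 2 ≤ n / (96 * J * s ^ 2) := by
      rw [hs, div_le_div_iff₀ (by positivity) (by positivity), div_pow, mul_pow]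
      have e : 2 * n * (96 * J * (q ^ 2 / (14 ^ 2 * (J : ℝ) ^ 2))) = n * q ^ 2 * (48 / 49 / J) := by
        field_simp
        norm_num
      rw [e]
      refine mul_le_of_le_one_right (by positivity) ?_
      rw [div_le_one (by positivity)]
      linarith
    have h2 : 1 ≤ n / q ^ 2 := by
      rw [le_div_iff₀ (by positivity)]
      nlinarith
    have h3 : T * q = ε * (n / q ^ 2) := by
      have : ε * n = q ^ 3 * T := by rw [hq3]; field_simp
      rw [← mul_div_assoc, this]
      field_simp
    have h4 : T * q ≤ ε * (n / (96 * J * s ^ 2) - 1) := by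
      rw [h3]
      gcongr
      have e : 2 * n / q ^ 2 = 2 * (n / q ^ 2) := by ring
      linarith
    refine le_trans (div_le_self (by positivity) ?_) h4
    have : (1 : ℝ) ≤ (J : ℝ) ^ 3 := one_le_pow₀ (by linarith)
    linarith
  · apply le_of_eq
    rw [hs]
    field_simp
    norm_num

lemma natLog_add_one_le {T : ℕ} (hT : 2 ≤ T) : ((Nat.log 2 T + 1 : ℕ) : ℝ) ≤ 3 * Real.log T := by
  have h1 : (2 : ℝ) ^ Nat.log 2 T ≤ T := by exact_mod_cast Nat.pow_log_le_self 2 (by omega)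
  have h2 := Real.log_le_log (by positivity) h1
  rw [Real.log_pow] at h2
  have h3 : Real.log 2 ≤ Real.log T :=
    Real.log_le_log (by norm_num) (by exact_mod_cast hT)
  have h4 := Real.log_two_gt_d9
  have h5 : (0 : ℝ) ≤ Nat.log 2 T := by positivity
  push_cast
  nlinarith

lemma exists_loss_regret_ge (A : Algorithm K) (hdiam : 1 ≤ Metric.diam (Set.univ : Set K)) {T : ℕ}
    (hKT : Fintype.card K ≤ T) :
    ∃ ℓ : Fin T → K → ℝ, (∀ t i, ℓ t i ∈ Set.Icc (0 : ℝ) 1) ∧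
      1 / 400000 * max (packingComplexity K ^ (1 / 3 : ℝ) * (T : ℝ) ^ (2 / 3 : ℝ))
        (√((Fintype.card K : ℝ) * (T : ℝ))) / Real.log T ^ 3 ≤ movementRegret A ℓ := by
  have hK : 2 ≤ Fintype.card K := (two_le_packingNumber hdiam).trans (packingNumber_le_card _)
  have hT : 2 ≤ T := hK.trans hKT
  have hT' : (2 : ℝ) ≤ T := by exact_mod_cast hT
  have hJlog := natLog_add_one_le hT
  have hTJ : T < 2 ^ (Nat.log 2 T + 1) := Nat.lt_pow_succ_log_self (by norm_num) T
  have hJ : 2 ≤ Nat.log 2 T + 1 := by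
    have := Nat.log_pos (b := 2) (by norm_num) hT
    omega
  set J := Nat.log 2 T + 1
  have hJ' : (2 : ℝ) ≤ J := by exact_mod_cast hJ
  have hlog : 0 < Real.log T := Real.log_pos (by linarith)
  -- Here `14784 = 2 * 7392`, the `2` being the loss in `hmain`, and `27 * 14784 ≤ 400000`, where
  -- `27` comes from `J ≤ 3 * log T`.
  have hfinal : ∀ {M R : ℝ}, 0 ≤ M → M / (14784 * J ^ 3) ≤ R →
      1 / 400000 * M / Real.log T ^ 3 ≤ R := fun {M R} hM h => by
    refine le_trans ?_ h
    rw [div_le_div_iff₀ (by positivity) (by positivity)]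
    have h3 : (J : ℝ) ^ 3 ≤ (3 * Real.log T) ^ 3 := by gcongr
    rw [mul_pow] at h3
    have h4 : 0 < Real.log T ^ 3 := by positivity
    nlinarith [mul_le_mul_of_nonneg_left h3 hM, mul_nonneg hM h4.le]
  rcases le_total (packingComplexity K ^ (1 / 3 : ℝ) * (T : ℝ) ^ (2 / 3 : ℝ))
    (√((Fintype.card K : ℝ) * (T : ℝ))) with hmax | hmax
  · rw [max_eq_right hmax]
    obtain ⟨ℓ, h01, hℓ⟩ := exists_loss_sqrt_le A hJ hTJ hK hKT
    refine ⟨ℓ, h01, hfinal (Real.sqrt_nonneg _) (le_trans ?_ hℓ)⟩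
    have : (J : ℝ) ^ 2 ≤ (J : ℝ) ^ 3 := by gcongr <;> [linarith; norm_num]
    gcongr
    norm_num
  · rw [max_eq_left hmax]
    obtain ⟨ε, hε0, hε1, hN2, hεN, hC⟩ := exists_packingComplexity_le hdiam
    obtain ⟨P, hP, hcard⟩ := exists_card_eq_packingNumber (K := K) ε
    rw [← hcard] at hN2 hεN hC
    obtain ⟨ℓ, h01, hℓ⟩ := exists_loss_packing_le A hJ hTJ hT hN2 ((card_le_univ P).trans hKT)
      hε0 hε1 (fun x hx y hy => le_dist_of_isPacking hε0.le hP hx hy) hεN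
    refine ⟨ℓ, h01, hfinal ((Real.sqrt_nonneg _).trans hmax) (le_trans ?_ hℓ)⟩
    have hx0 : 0 ≤ ε * #P / T := by positivity
    -- The factor `4` lost in choosing `ε` is rounded up to `8 = 2 ^ 3` for a clean cube root.
    have hmain : packingComplexity K ^ (1 / 3 : ℝ) * (T : ℝ) ^ (2 / 3 : ℝ)
        ≤ 2 * (T * (ε * #P / T) ^ (1 / 3 : ℝ)) := by
      have h0 : 0 ≤ packingComplexity K := Real.sSup_nonneg (by
        rintro _ ⟨r, hr, rfl⟩
        exact mul_nonneg hr.1.le (Nat.cast_nonneg _))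
      calc packingComplexity K ^ (1 / 3 : ℝ) * (T : ℝ) ^ (2 / 3 : ℝ)
          ≤ (2 ^ 3 * T * (ε * #P / T)) ^ (1 / 3 : ℝ) * (T : ℝ) ^ (2 / 3 : ℝ) := by
            gcongr
            have e : 2 ^ 3 * T * (ε * #P / T) = 8 * (ε * #P) := by
              field_simp
              norm_num
            rw [e]
            linarith
        _ = 2 * ((T : ℝ) ^ (1 / 3 : ℝ) * (T : ℝ) ^ (2 / 3 : ℝ)
              * (ε * #P / T) ^ (1 / 3 : ℝ)) := by
            rw [Real.mul_rpow (by positivity) hx0, Real.mul_rpow (by positivity) (by positivity),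
              ← Real.rpow_natCast 2 3, ← Real.rpow_mul (by norm_num)]
            norm_num
            ring
        _ = _ := by
            rw [← Real.rpow_add (by positivity)]
            norm_num
    rw [div_le_div_iff₀ (by positivity) (by positivity)]
    have h3 : (0 : ℝ) < (J : ℝ) ^ 3 := by positivity
    nlinarith

end LowerBound

end MovementBandit

theorem theorem2 :
    ∃ c : ℝ, 0 < c ∧ ∃ p : ℕ,
      ∀ (K : Type*) [Fintype K] [MetricSpace K],
        1 ≤ Metric.diam (Set.univ : Set K) →
        ∀ T : ℕ, Fintype.card K ≤ T →
        ∀ A : MovementBandit.Algorithm K,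
          ∃ ℓ : Fin T → K → ℝ, (∀ t i, ℓ t i ∈ Set.Icc (0 : ℝ) 1) ∧
            c * max (MovementBandit.packingComplexity K ^ (1 / 3 : ℝ) * (T : ℝ) ^ (2 / 3 : ℝ))
                (√((Fintype.card K : ℝ) * (T : ℝ))) / (Real.log T) ^ p
              ≤ MovementBandit.movementRegret A ℓ := by
  classical
  exact ⟨1 / 400000, by norm_num, 3, fun K _ _ hdiam T hKT A =>
    MovementBandit.exists_loss_regret_ge A hdiam hKT⟩
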